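/- Let $q=0.1$, and for $Q>2$ put $r=2-1/Q$. Given $\delta_0\in(0,q)$, $\alpha_0>0$, an orthonormal basis $\mathbf a,\mathbf b$ of $\mathbb R^2$ and $N\in\mathbb N$, define a $2\times2$ matrix weight $W=W_{Q,\delta_0}$ on $I^0=[0,1)$ as follows. Put $\beta_0=\alpha_0(\delta_0/q)^2$, $\alpha_0^\#=Q/\beta_0$, $\beta_0^\#=Q/\alpha_0$, and for $n\ge 0$, with $\delta_n=q(\beta_n/\alpha_n)^{1/2}$, $$\widetilde\alpha_n=\frac{\alpha_n-\delta_n^2\beta_n}{1-\delta_n^2},\quad \widetilde\beta_n=\frac{\beta_n-\delta_n^2\alpha_n}{1-\delta_n^2},\quad \widetilde\alpha_n^\#=\frac{\alpha_n^\#-\delta_n^2\beta_n^\#}{1-\delta_n^2},\quad \widetilde\beta_n^\#=\frac{\beta_n^\#-\delta_n^2\alpha_n^\#}{1-\delta_n^2},\quad s_n=\widetilde\alpha_n\widetilde\beta_n^\#/Q,$$ $$\alpha_{n+1}=r\widetilde\alpha_n,\quad \beta_{n+1}=\frac{\widetilde\beta_n}{s_nr},\quad \alpha^\#_{n+1}=r\widetilde\alpha^\#_n,\quad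 \beta^\#_{n+1}=\frac{\widetilde\beta^\#_n}{s_nr}.$$ Let $I_-,I_+$ denote the left and right halves of a dyadic interval $I$. Let $I^0$ be the only stopping interval of generation $0$, with axes $\mathbf a_{I^0}=\mathbf a$, $\mathbf b_{I^0}=\mathbf b$. If $I$ is a stopping interval of generation $n<N$ with axes $\mathbf a_I,\mathbf b_I$, put $\mathbf a_{I_\pm}=(1+\delta_n^2)^{-1/2}(\mathbf a_I\pm\delta_n\mathbf b_I)$ and $\mathbf b_{I_\pm}=(1+\delta_n^2)^{-1/2}(\mathbf b_I\mp\delta_n\mathbf a_I)$. For each $J\in\{I_-,I_+\}$, the right half $J_+$ is a stopping interval of generation $n+1$ with axes $\mathbf a_J,\mathbf b_J$, and the left half $J_-$ is a terminal interval. For a positive definite pair $(\mathbf w,\mathbf v)$ with $\mathbf v^{-1}\le\mathbf w$, "stopping on $K$ with averages $(\mathbf w,\mathbf v)$" means setting $W=\mathbf w^{1/2}(\mathbf I\pm\Delta)\mathbf w^{1/2}$ on $K_\pm$, where $\Delta=(\mathbf I-\mathbf w^{-1/2}\mathbf v^{-1}\mathbf w^{-1/2})^{1/2}$; then $\langle W\rangle_K=\mathbf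 w$ and $\langle W^{-1}\rangle_K=\mathbf v$. On each terminal interval $J_-$ as above $W$ is obtained by stopping with $$\mathbf v=(2-r)\widetilde\alpha_n\mathbf a_J\mathbf a_J^*+\Bigl(2-\frac1{s_nr}\Bigr)\widetilde\beta_n\mathbf b_J\mathbf b_J^*,\qquad \mathbf w=\Bigl(2-\frac1{s_nr}\Bigr)\widetilde\beta_n^\#\mathbf a_J\mathbf a_J^*+(2-r)\widetilde\alpha_n^\#\mathbf b_J\mathbf b_J^*,$$ and on each stopping interval $I$ of the last generation $N$ by stopping with $\mathbf v=\alpha_N\mathbf a_I\mathbf a_I^*+\beta_N\mathbf b_I\mathbf b_I^*$, $\mathbf w=\beta_N^\#\mathbf a_I\mathbf a_I^*+\alpha_N^\#\mathbf b_I\mathbf b_I^*$. Let $\mathscr D$ be the set of dyadic subintervals of $I^0$, let $h_I=|I|^{-1/2}(\mathbf 1_{I_+}-\mathbf 1_{I_-})$, and let $$Ш f=\sum_{I\in\mathscr D}(f,h_I)\,[h_{I_+}-h_{I_-}],\qquad (f,h_I)=\int f h_I\in\mathbb R^2,\qquad \|g\|_{L^2(W)}^2=\int_{I^0}(W(x)g(x),g(x))\,dx$$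 (the classical Haar shift and the weighted norm). **Theorem.** There is an absolute constant $c>0$ such that for all sufficiently large $Q$, all sufficiently small $\delta_0>0$ (depending on $Q$) and all sufficiently large $N$ (depending on $Q$ and $\delta_0$), and for all $\alpha_0>0$ and all orthonormal bases $\mathbf a,\mathbf b$ of $\mathbb R^2$, the following holds for the weight $W$ above. The values of $W$ are positive definite, $W$ and $W^{-1}$ are integrable, and the dyadic matrix $\mathbf A_2$ characteristic of $W$ equals $Q$: $$\sup_{I\in\mathscr D}\bigl\|\langle W\rangle_I^{1/2}\langle W^{-1}\rangle_I^{1/2}\bigr\|^2=Q.$$ Moreover, for $f=\mathbf 1_{I^0}W^{-1}e$ with $e=\mathbf a$ or $e=\mathbf a+\mathbf b$: $f\in L^2(W)$, $f\neq0$ in $L^2(W)$, only finitely many of the coefficients $(f,h_I)$ are non-zero, $Ш f\in L^2(W)$, and $$\|Ш f\|_{L^2(W)}\ \ge\ c\,Q^{3/2}\,\|f\|_{L^2(W)}.$$ -/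

import Mathlib

open MeasureTheory

noncomputable section

namespace HaarLower

/-- The plane `ℝ²` with its Euclidean inner product. -/
abbrev Plane : Type := EuclideanSpace ℝ (Fin 2)

/-- Real `2 × 2` matrices. -/
abbrev Mat : Type := Matrix (Fin 2) (Fin 2) ℝ

/-- The unit interval `I⁰ = [0,1)`. -/
def unitInterval : Set ℝ := Set.Ico 0 1

/-- The action of a matrix on a vector of the plane. -/
def act (A : Mat) (x : Plane) : Plane := WithLp.toLp 2 (A.mulVec x.ofLp)

/-- The matrix `x • a a* + y • b b*`. -/
def diagMat (a b : Plane) (x y : ℝ) : Mat :=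
  x • Matrix.vecMulVec a.ofLp a.ofLp + y • Matrix.vecMulVec b.ofLp b.ofLp

/-! ### Dyadic intervals and Haar functions -/

/-- The dyadic subintervals of `[0,1)`: the pair `⟨k, j⟩` with `0 ≤ j < 2 ^ k` stands for the
interval `[j 2⁻ᵏ, (j+1) 2⁻ᵏ)`. -/
abbrev DyadicInterval : Type := Σ k : ℕ, Fin (2 ^ k)

namespace DyadicInterval

/-- The interval itself. -/
def set (I : DyadicInterval) : Set ℝ :=
  Set.Ico ((I.2 : ℝ) / 2 ^ I.1) (((I.2 : ℝ) + 1) / 2 ^ I.1)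

/-- The length `|I|`. -/
def length (I : DyadicInterval) : ℝ := ((2 : ℝ) ^ I.1)⁻¹

/-- The left child `I₋`. -/
def left (I : DyadicInterval) : DyadicInterval :=
  ⟨I.1 + 1, ⟨2 * (I.2 : ℕ), by have := I.2.isLt; rw [pow_succ]; omega⟩⟩

/-- The right child `I₊`. -/
def right (I : DyadicInterval) : DyadicInterval :=
  ⟨I.1 + 1, ⟨2 * (I.2 : ℕ) + 1, by have := I.2.isLt; rw [pow_succ]; omega⟩⟩

/-- The `L²`-normalized Haar function `h_I = |I|^{-1/2} (1_{I₊} - 1_{I₋})`. -/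
def haar (I : DyadicInterval) (x : ℝ) : ℝ :=
  (Real.sqrt I.length)⁻¹ * (I.right.set.indicator 1 x - I.left.set.indicator 1 x)

end DyadicInterval

/-- The (vector) Haar coefficient `(f, h_I) = ∫ f h_I`. -/
def haarCoeff (f : ℝ → Plane) (I : DyadicInterval) : Plane := ∫ x, I.haar x • f x

/-- The classical Haar shift `Ш f = ∑_{I ∈ 𝒟} (f, h_I) (h_{I₊} - h_{I₋})`, as a pointwise series.
It is applied below only to functions with finitely many non-zero Haar coefficients. -/
def haarShift (f : ℝ → Plane) (x : ℝ) : Plane :=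
  ∑' I : DyadicInterval, (I.right.haar x - I.left.haar x) • haarCoeff f I

/-! ### Matrix weights on `[0,1)` -/

/-- A `2 × 2` matrix weight on `[0,1)`: an integrable function with values in the positive
semidefinite matrices. -/
def IsMatrixWeight (W : ℝ → Mat) : Prop :=
  (∀ x ∈ unitInterval, (W x).PosSemidef) ∧
    ∀ i j, IntegrableOn (fun x => W x i j) unitInterval

/-- The average `⟨W⟩_I = |I|⁻¹ ∫_I W`. -/
def average (W : ℝ → Mat) (I : DyadicInterval) : Mat :=
  Matrix.of fun i j => I.length⁻¹ * ∫ x in I.set, W x i j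

/-- The norm of a matrix as an operator on the Euclidean plane. -/
def opNorm (A : Mat) : ℝ := ‖Matrix.toEuclideanCLM (n := Fin 2) (𝕜 := ℝ) A‖

open scoped MatrixOrder in
/-- The positive square root of a positive semidefinite matrix. -/
def sqrtMat (A : Mat) : Mat := CFC.sqrt A

/-- `Q` is the dyadic matrix `A₂` characteristic of `W`:
`Q = sup_{I ∈ 𝒟} ‖⟨W⟩_I^{1/2} ⟨W⁻¹⟩_I^{1/2}‖²` (in particular, the supremum is finite). -/
def HasDyadicA2Char (W : ℝ → Mat) (Q : ℝ) : Prop :=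
  IsLUB (Set.range fun I : DyadicInterval =>
    opNorm (sqrtMat (average W I) * sqrtMat (average (fun x => (W x)⁻¹) I)) ^ 2) Q

/-- Membership of (the restriction to `[0,1)` of) `g` in `L²(W)`. -/
def MemL2 (W : ℝ → Mat) (g : ℝ → Plane) : Prop :=
  AEStronglyMeasurable g (volume.restrict unitInterval) ∧
    IntegrableOn (fun x => inner ℝ (act (W x) (g x)) (g x)) unitInterval

/-- The norm of `L²(W)`: `‖g‖² = ∫ (W g, g)` over `[0,1)`. -/
def normL2 (W : ℝ → Mat) (g : ℝ → Plane) : ℝ :=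
  Real.sqrt (∫ x in unitInterval, inner ℝ (act (W x) (g x)) (g x))

/-! ### The weight -/

/-- The small parameter `q = 0.1`. -/
def q : ℝ := 1 / 10

/-- The stretching parameter `r = 2 - 1/Q`. -/
def stretch (Q : ℝ) : ℝ := 2 - 1 / Q

/-- The eigenvalues `α, β, α#, β#`: in the principal axes `a`, `b` of an interval the average of
`W⁻¹` is `α a a* + β b b*`, and the average of `W` is `β# a a* + α# b b*`. -/
structure Eig where
  al : ℝ
  be : ℝ
  alS : ℝ
  beS : ℝ

namespace Eig

/-- The rotation parameter `δ = q (β/α)^{1/2}`. -/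
def delta (p : Eig) : ℝ := q * Real.sqrt (p.be / p.al)

/-- The eigenvalues `α̃, β̃, α̃#, β̃#` after the rotation. -/
def rotated (p : Eig) : Eig where
  al := (p.al - p.delta ^ 2 * p.be) / (1 - p.delta ^ 2)
  be := (p.be - p.delta ^ 2 * p.al) / (1 - p.delta ^ 2)
  alS := (p.alS - p.delta ^ 2 * p.beS) / (1 - p.delta ^ 2)
  beS := (p.beS - p.delta ^ 2 * p.alS) / (1 - p.delta ^ 2)

/-- The ratio `s = α̃ β̃# / Q`. -/
def ratio (Q : ℝ) (p : Eig) : ℝ := p.rotated.al * p.rotated.beS / Q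

/-- The eigenvalues on the right (stopping) child after rotation and stretching:
`(x, y) ↦ (r x, y / (s r))` for `(x, y) = (α̃, β̃#)` and `(x, y) = (α̃#, β̃)`. -/
def next (Q : ℝ) (p : Eig) : Eig where
  al := stretch Q * p.rotated.al
  be := p.rotated.be / (p.ratio Q * stretch Q)
  alS := stretch Q * p.rotated.alS
  beS := p.rotated.beS / (p.ratio Q * stretch Q)

/-- The eigenvalues on the left (terminal) child after rotation and stretching:
`(x, y) ↦ ((2 - r) x, (2 - 1 / (s r)) y)`. -/
def terminal (Q : ℝ) (p : Eig) : Eig where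
  al := (2 - stretch Q) * p.rotated.al
  be := (2 - 1 / (p.ratio Q * stretch Q)) * p.rotated.be
  alS := (2 - stretch Q) * p.rotated.alS
  beS := (2 - 1 / (p.ratio Q * stretch Q)) * p.rotated.beS

/-- The initial eigenvalues: `δ₀ = q (β₀/α₀)^{1/2}`, `α₀ β₀# = β₀ α₀# = Q`. -/
def initial (Q δ₀ α₀ : ℝ) : Eig where
  al := α₀
  be := α₀ * (δ₀ / q) ^ 2
  alS := Q / (α₀ * (δ₀ / q) ^ 2)
  beS := Q / α₀

end Eig

/-- The rotated vector `(1+δ²)^{-1/2} (u + δ v)`. -/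
def turn (δ : ℝ) (u v : Plane) : Plane := (Real.sqrt (1 + δ ^ 2))⁻¹ • (u + δ • v)

/-- The weight on `[0,1)` that is constant on the two halves, with average
`w = β# a a* + α# b b*` and with average of the inverse equal to `v = α a a* + β b b*`.
It equals `w^{1/2} (1 + Δ) w^{1/2}` on the right half and `w^{1/2} (1 - Δ) w^{1/2}` on the left one,
where `Δ = (1 - w^{-1/2} v⁻¹ w^{-1/2})^{1/2}`, written out in the common eigenbasis. -/
def stopWeight (p : Eig) (a b : Plane) (x : ℝ) : Mat :=
  let da := Real.sqrt (1 - 1 / (p.al * p.beS))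
  let db := Real.sqrt (1 - 1 / (p.be * p.alS))
  if x < 1 / 2 then diagMat a b (p.beS * (1 - da)) (p.alS * (1 - db))
  else diagMat a b (p.beS * (1 + da)) (p.alS * (1 + db))

/-- The weight on a stopping interval with eigenvalues `p` and principal axes `a`, `b`, when `N`
further generations of stopping intervals are to be constructed. The interval is transported
affinely onto `[0,1)`, and so are its quarters: from left to right `I₋₋` (terminal), `I₋₊`
(stopping), `I₊₋` (terminal), `I₊₊` (stopping). The axes on `I_±` are
`(1+δ²)^{-1/2} (a ± δ b)` and `(1+δ²)^{-1/2} (b ∓ δ a)`. -/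
def weightAux (Q : ℝ) : ℕ → Eig → Plane → Plane → ℝ → Mat
  | 0, p, a, b, x => stopWeight p a b x
  | N + 1, p, a, b, x =>
    let δ := p.delta
    if x < 1 / 4 then
      stopWeight (p.terminal Q) (turn (-δ) a b) (turn δ b a) (4 * x)
    else if x < 1 / 2 then
      weightAux Q N (p.next Q) (turn (-δ) a b) (turn δ b a) (4 * x - 1)
    else if x < 3 / 4 then
      stopWeight (p.terminal Q) (turn δ a b) (turn (-δ) b a) (4 * x - 2)
    else
      weightAux Q N (p.next Q) (turn δ a b) (turn (-δ) b a) (4 * x - 3)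

/-- The dyadic weight `W = W_{Q, δ₀}` on `[0,1)`, with initial eigenvalue `α₀` and initial principal
axes `u 0 = a_{I⁰}`, `u 1 = b_{I⁰}`, terminated at the stopping intervals of generation `N`. -/
def weight (Q δ₀ α₀ : ℝ) (u : OrthonormalBasis (Fin 2) ℝ Plane) (N : ℕ) : ℝ → Mat :=
  weightAux Q N (Eig.initial Q δ₀ α₀) (u 0) (u 1)

/-- The test function `f = 1_{I⁰} W⁻¹ e`. -/
def testFunction (W : ℝ → Mat) (e : Plane) : ℝ → Plane :=
  unitInterval.indicator fun x => act (W x)⁻¹ e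

end HaarLower

end

/-!
On the stopping intervals `⟨W⁻¹⟩ = α a a* + β b b*` and `⟨W⟩ = (Q / D) (β a a* + α b b*)`, where the
product `D = α β` never changes. The stretching gives `W⁻¹ e` a Haar coefficient of size `α` along
`a` on each half of a stopping interval. The Haar shift moves it to the children of that half, and
the next rotation, by an angle of about `± δ`, turns it into a component of size `δ α = √D / 10`
along `-b`. The signs agree, so that the component of `Ш f` along `-b` grows linearly with the
generation. The rotations of the axes also contribute to the Haar coefficients, but much less.

In generation `n`, `α` has grown to about `(2 - 1 / Q) ^ n α₀`, and the terminal intervals, of total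
measure about `2 ^ (-n)`, see the component along `b` with weight about `α / D`. They contribute
about `2 ^ (-n) (α / D) n² D ≈ (1 - 1 / (2 Q)) ^ n n² α₀` to the square of the norm of `Ш f`. The
first `Q` generations together give `Q³ α₀`, whereas `‖f‖² = (⟨W⁻¹⟩ e, e) ≤ 2 α₀`.
-/

noncomputable section

namespace HaarLower

open scoped InnerProductSpace

/-! ### Functions and step functions on the unit interval -/

section Glue

variable {X : Type*}

/-- The function on `[0,1)` whose restrictions to the left and the right half become `f` and `g`
when the halves are transported affinely onto `[0,1)`. -/
def glue (f g : ℝ → X) (x : ℝ) : X := if x < 1 / 2 then f (2 * x) else g (2 * x - 1)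

theorem glue_of_lt {f g : ℝ → X} {x : ℝ} (hx : x < 1 / 2) : glue f g x = f (2 * x) := if_pos hx

theorem glue_of_le {f g : ℝ → X} {x : ℝ} (hx : 1 / 2 ≤ x) : glue f g x = g (2 * x - 1) :=
  if_neg hx.not_gt

theorem two_mul_sub_one_notMem {x : ℝ} (hx : 2 * x ∈ unitInterval) :
    2 * x - 1 ∉ unitInterval := fun hx' => by linarith [hx.2, hx'.1]

theorem glue_of_two_mul_mem {f g : ℝ → X} {x : ℝ} (hx : 2 * x ∈ unitInterval) :
    glue f g x = f (2 * x) := glue_of_lt (by linarith [hx.2])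

theorem glue_of_two_mul_sub_one_mem {f g : ℝ → X} {x : ℝ} (hx : 2 * x - 1 ∈ unitInterval) :
    glue f g x = g (2 * x - 1) := glue_of_le (by linarith [hx.1])

theorem two_mul_mem_or {x : ℝ} (hx : x ∈ unitInterval) :
    2 * x ∈ unitInterval ∨ 2 * x - 1 ∈ unitInterval := by
  simp only [unitInterval, Set.mem_Ico] at hx ⊢
  grind

theorem eqOn_glue {h f g : ℝ → X}
    (hf : ∀ x, 2 * x ∈ unitInterval → h x = f (2 * x))
    (hg : ∀ x, 2 * x - 1 ∈ unitInterval → h x = g (2 * x - 1)) :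
    Set.EqOn h (glue f g) unitInterval := fun x hx => by
  rcases two_mul_mem_or hx with hx | hx
  · rw [hf x hx, glue_of_two_mul_mem hx]
  · rw [hg x hx, glue_of_two_mul_sub_one_mem hx]

theorem indicator_glue [AddZeroClass X] (f g : ℝ → X) (x : ℝ) :
    unitInterval.indicator (glue f g) x =
      unitInterval.indicator f (2 * x) + unitInterval.indicator g (2 * x - 1) := by
  classical
  simp only [Set.indicator_apply, glue, unitInterval, Set.mem_Ico]
  split_ifs <;> grind [zero_add, add_zero]

theorem stronglyMeasurable_glue [TopologicalSpace X] {f g : ℝ → X} (hf : StronglyMeasurable f)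
    (hg : StronglyMeasurable g) : StronglyMeasurable (glue f g) :=
  StronglyMeasurable.ite measurableSet_Iio (hf.comp_measurable (by fun_prop))
    (hg.comp_measurable (by fun_prop))

end Glue

section Halving

variable {F : Type*} [NormedAddCommGroup F]

theorem measurableSet_unitInterval : MeasurableSet unitInterval := measurableSet_Ico

theorem integrable_comp_two_mul {g : ℝ → F} (hg : Integrable g) :
    Integrable fun x => g (2 * x) :=
  hg.comp_mul_left' two_ne_zero

theorem integrable_comp_two_mul_sub_one {g : ℝ → F} (hg : Integrable g) :
    Integrable fun x => g (2 * x - 1) :=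
  integrable_comp_two_mul (hg.comp_sub_right 1)

theorem integrableOn_glue {f g : ℝ → F} (hf : IntegrableOn f unitInterval)
    (hg : IntegrableOn g unitInterval) : IntegrableOn (glue f g) unitInterval := by
  rw [← integrable_indicator_iff measurableSet_unitInterval] at hf hg ⊢
  rw [funext (indicator_glue f g)]
  exact (integrable_comp_two_mul hf).add (integrable_comp_two_mul_sub_one hg)

variable [NormedSpace ℝ F]

theorem integral_comp_two_mul (g : ℝ → F) : ∫ x, g (2 * x) = (1 / 2 : ℝ) • ∫ x, g x := by
  rw [Measure.integral_comp_mul_left g 2]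
  norm_num

theorem integral_comp_two_mul_sub_one (g : ℝ → F) :
    ∫ x, g (2 * x - 1) = (1 / 2 : ℝ) • ∫ x, g x := by
  rw [integral_comp_two_mul fun x => g (x - 1), integral_sub_right_eq_self g 1]

theorem setIntegral_glue {f g : ℝ → F} (hf : IntegrableOn f unitInterval)
    (hg : IntegrableOn g unitInterval) : ∫ x in unitInterval, glue f g x =
      (1 / 2 : ℝ) • ((∫ x in unitInterval, f x) + ∫ x in unitInterval, g x) := by
  rw [← integrable_indicator_iff measurableSet_unitInterval] at hf hg
  simp only [← integral_indicator measurableSet_unitInterval]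
  rw [funext (indicator_glue f g), integral_add (integrable_comp_two_mul hf)
    (integrable_comp_two_mul_sub_one hg), integral_comp_two_mul, integral_comp_two_mul_sub_one,
    smul_add]

theorem setIntegral_unitInterval_const [CompleteSpace F] (c : F) :
    ∫ _ in unitInterval, c = c := by
  simp [unitInterval]

end Halving

/-- A dyadic step function on `[0,1)`: a `leaf` is a constant function, a `node` glues the step
functions on the two halves. -/
inductive DyadicTree (X : Type*)
  | leaf : X → DyadicTree X
  | node : DyadicTree X → DyadicTree X → DyadicTree X

namespace DyadicTree

variable {X Y Z : Type*}

/-- The step function described by a tree. -/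
def eval : DyadicTree X → ℝ → X
  | leaf v => fun _ => v
  | node l r => glue l.eval r.eval

/-- Postcomposition of a step function with `φ`. -/
def map (φ : X → Y) : DyadicTree X → DyadicTree Y
  | leaf v => leaf (φ v)
  | node l r => node (l.map φ) (r.map φ)

/-- The average of a step function over `[0,1)`. -/
def mean [AddCommGroup X] [Module ℝ X] : DyadicTree X → X
  | leaf v => v
  | node l r => (1 / 2 : ℝ) • (l.mean + r.mean)

/-- All values of the step function satisfy `P`. -/
def All (P : X → Prop) : DyadicTree X → Prop
  | leaf v => P v
  | node l r => l.All P ∧ r.All P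

theorem All.eval {P : X → Prop} {t : DyadicTree X} (ht : t.All P) (x : ℝ) : P (t.eval x) := by
  induction t generalizing x with
  | leaf v => exact ht
  | node l r ihl ihr =>
    rcases lt_or_ge x (1 / 2) with hx | hx
    · simpa only [DyadicTree.eval, glue_of_lt hx] using ihl ht.1 _
    · simpa only [DyadicTree.eval, glue_of_le hx] using ihr ht.2 _

theorem All.imp {P R : X → Prop} (h : ∀ v, P v → R v) {t : DyadicTree X} (ht : t.All P) :
    t.All R := by
  induction t with
  | leaf v => exact h v ht
  | node l r ihl ihr => exact ⟨ihl ht.1, ihr ht.2⟩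

theorem All.map {P : X → Prop} {R : Y → Prop} {φ : X → Y} (h : ∀ v, P v → R (φ v))
    {t : DyadicTree X} (ht : t.All P) : (t.map φ).All R := by
  induction t with
  | leaf v => exact h v ht
  | node l r ihl ihr => exact ⟨ihl ht.1, ihr ht.2⟩

theorem eval_map (φ : X → Y) (t : DyadicTree X) (x : ℝ) : (t.map φ).eval x = φ (t.eval x) := by
  induction t generalizing x with
  | leaf v => rfl
  | node l r ihl ihr => simp only [map, eval, glue, ihl, ihr, apply_ite φ]

theorem map_map (φ : X → Y) (ψ : Y → Z) (t : DyadicTree X) : (t.map φ).map ψ = t.map (ψ ∘ φ) := by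
  induction t with
  | leaf v => rfl
  | node l r ihl ihr => simp only [map, ihl, ihr]

theorem mean_map [AddCommGroup X] [Module ℝ X] [AddCommGroup Y] [Module ℝ Y] (φ : X →ₗ[ℝ] Y)
    (t : DyadicTree X) : (t.map φ).mean = φ t.mean := by
  induction t with
  | leaf v => rfl
  | node l r ihl ihr => simp only [mean, map, ihl, ihr, map_smul, map_add]

theorem stronglyMeasurable_eval [TopologicalSpace X] (t : DyadicTree X) :
    StronglyMeasurable t.eval := by
  induction t with
  | leaf v => exact stronglyMeasurable_const
  | node l r ihl ihr => exact stronglyMeasurable_glue ihl ihr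

variable {F : Type*} [NormedAddCommGroup F]

theorem integrableOn_eval (t : DyadicTree F) : IntegrableOn t.eval unitInterval := by
  induction t with
  | leaf v => exact integrableOn_const (by simp [unitInterval])
  | node l r ihl ihr => exact integrableOn_glue ihl ihr

theorem setIntegral_eval [NormedSpace ℝ F] [CompleteSpace F] (t : DyadicTree F) :
    ∫ x in unitInterval, t.eval x = t.mean := by
  induction t with
  | leaf v => exact setIntegral_unitInterval_const v
  | node l r ihl ihr =>
    simp only [eval, mean, setIntegral_glue l.integrableOn_eval r.integrableOn_eval, ihl, ihr]

end DyadicTree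

/-! ### Dyadic intervals of the two halves -/

namespace DyadicInterval

/-- The interval `[0,1)` itself. -/
def root : DyadicInterval := ⟨0, 0⟩

/-- The image of a dyadic interval under `x ↦ x / 2`. -/
def lower (I : DyadicInterval) : DyadicInterval :=
  ⟨I.1 + 1, ⟨I.2, by have := I.2.isLt; rw [pow_succ]; omega⟩⟩

/-- The image of a dyadic interval under `x ↦ (x + 1) / 2`. -/
def upper (I : DyadicInterval) : DyadicInterval :=
  ⟨I.1 + 1, ⟨2 ^ I.1 + I.2, by have := I.2.isLt; rw [pow_succ]; omega⟩⟩

theorem eq_root_or (I : DyadicInterval) :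
    I = root ∨ (∃ J, lower J = I) ∨ ∃ J, upper J = I := by
  obtain ⟨k, j, hj⟩ := I
  cases k with
  | zero =>
    obtain rfl : j = 0 := by simpa using hj
    exact Or.inl rfl
  | succ k =>
    right
    by_cases hjk : j < 2 ^ k
    · exact Or.inl ⟨⟨k, ⟨j, hjk⟩⟩, rfl⟩
    · refine Or.inr ⟨⟨k, ⟨j - 2 ^ k, by rw [pow_succ] at hj; omega⟩⟩, ?_⟩
      exact Sigma.ext rfl (heq_of_eq (Fin.ext (by simp only [upper]; omega)))

theorem forall_iff {P : DyadicInterval → Prop} :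
    (∀ I, P I) ↔ P root ∧ (∀ I, P (lower I)) ∧ ∀ I, P (upper I) := by
  refine ⟨fun h => ⟨h _, fun I => h _, fun I => h _⟩, fun ⟨h_root, h_lower, h_upper⟩ I => ?_⟩
  rcases I.eq_root_or with rfl | ⟨J, rfl⟩ | ⟨J, rfl⟩
  exacts [h_root, h_lower J, h_upper J]

theorem lower_injective : Function.Injective lower := by
  rintro ⟨k, j⟩ ⟨k', j'⟩ h
  obtain rfl : k = k' := by simpa [lower] using congrArg Sigma.fst h
  simpa [lower, Fin.ext_iff] using h

theorem upper_injective : Function.Injective upper := by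
  rintro ⟨k, j⟩ ⟨k', j'⟩ h
  obtain rfl : k = k' := by simpa [upper] using congrArg Sigma.fst h
  simpa [upper, Fin.ext_iff] using h

theorem lower_ne_root (I : DyadicInterval) : lower I ≠ root := fun h => by
  simpa [lower, root] using congrArg Sigma.fst h

theorem upper_ne_root (I : DyadicInterval) : upper I ≠ root := fun h => by
  simpa [upper, root] using congrArg Sigma.fst h

theorem lower_ne_upper (I J : DyadicInterval) : lower I ≠ upper J := by
  obtain ⟨k, j⟩ := I
  obtain ⟨k', j'⟩ := J
  intro h
  obtain rfl : k = k' := by simpa [lower, upper] using congrArg Sigma.fst h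
  have : (j : ℕ) = 2 ^ k + j' := by simpa [lower, upper] using h
  omega

theorem left_lower (I : DyadicInterval) : I.lower.left = I.left.lower := rfl

theorem right_lower (I : DyadicInterval) : I.lower.right = I.right.lower := rfl

theorem left_upper (I : DyadicInterval) : I.upper.left = I.left.upper :=
  Sigma.ext rfl (heq_of_eq (Fin.ext (by simp only [upper, left]; ring)))

theorem right_upper (I : DyadicInterval) : I.upper.right = I.right.upper :=
  Sigma.ext rfl (heq_of_eq (Fin.ext (by simp only [upper, right]; ring)))

theorem left_root : root.left = root.lower := rfl

theorem right_root : root.right = root.upper := rfl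

theorem set_root : root.set = unitInterval := by simp [root, set, unitInterval]

theorem mem_set_lower {I : DyadicInterval} {x : ℝ} : x ∈ I.lower.set ↔ 2 * x ∈ I.set := by
  simp only [lower, set, Set.mem_Ico, pow_succ, ← div_div]
  rw [div_le_iff₀' two_pos, lt_div_iff₀' two_pos]

theorem mem_set_upper {I : DyadicInterval} {x : ℝ} : x ∈ I.upper.set ↔ 2 * x - 1 ∈ I.set := by
  simp only [upper, set, Set.mem_Ico, pow_succ, ← div_div, Nat.cast_add, Nat.cast_pow,
    Nat.cast_ofNat, add_assoc]
  rw [div_le_iff₀' two_pos, lt_div_iff₀' two_pos, add_div, add_div _ ((I.2 : ℝ) + 1),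
    div_self (by positivity), le_sub_iff_add_le', sub_lt_iff_lt_add']

theorem set_subset (I : DyadicInterval) : I.set ⊆ unitInterval := by
  have : ((I.2 : ℕ) : ℝ) + 1 ≤ 2 ^ I.1 := by exact_mod_cast I.2.isLt
  exact Set.Ico_subset_Ico (by positivity) ((div_le_one (by positivity)).2 this)

theorem measurableSet_set (I : DyadicInterval) : MeasurableSet I.set := measurableSet_Ico

theorem length_pos (I : DyadicInterval) : 0 < I.length := by
  unfold length
  positivity

theorem length_lower (I : DyadicInterval) : I.lower.length = I.length / 2 := by
  simp only [lower, length, pow_succ, mul_inv, div_eq_mul_inv]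

theorem length_upper (I : DyadicInterval) : I.upper.length = I.length / 2 := by
  simp only [upper, length, pow_succ, mul_inv, div_eq_mul_inv]

theorem volume_real_set (I : DyadicInterval) : volume.real I.set = I.length := by
  have : (0 : ℝ) ≤ (2 ^ I.1)⁻¹ := by positivity
  simp only [set, length, Measure.real, Real.volume_Ico, ← sub_div, add_sub_cancel_left, one_div,
    ENNReal.toReal_ofReal this]

theorem indicator_set_lower (I : DyadicInterval) (x : ℝ) :
    I.lower.set.indicator (1 : ℝ → ℝ) x = I.set.indicator 1 (2 * x) := by
  classical simp [Set.indicator_apply, mem_set_lower]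

theorem indicator_set_upper (I : DyadicInterval) (x : ℝ) :
    I.upper.set.indicator (1 : ℝ → ℝ) x = I.set.indicator 1 (2 * x - 1) := by
  classical simp [Set.indicator_apply, mem_set_upper]

theorem inv_sqrt_length_div_two (I : DyadicInterval) :
    (√(I.length / 2))⁻¹ = √2 * (√I.length)⁻¹ := by
  rw [Real.sqrt_div I.length_pos.le, inv_div, div_eq_mul_inv]

theorem haar_lower (I : DyadicInterval) (x : ℝ) : I.lower.haar x = √2 * I.haar (2 * x) := by
  simp only [haar, length_lower, inv_sqrt_length_div_two, left_lower, right_lower,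
    indicator_set_lower, mul_assoc]

theorem haar_upper (I : DyadicInterval) (x : ℝ) : I.upper.haar x = √2 * I.haar (2 * x - 1) := by
  simp only [haar, length_upper, inv_sqrt_length_div_two, left_upper, right_upper,
    indicator_set_upper, mul_assoc]

theorem haar_root (x : ℝ) : root.haar x =
    unitInterval.indicator 1 (2 * x - 1) - unitInterval.indicator 1 (2 * x) := by
  have : root.length = 1 := by simp [root, length]
  simp only [haar, this, Real.sqrt_one, inv_one, one_mul, left_root, right_root,
    indicator_set_lower, indicator_set_upper, set_root]

theorem haar_root_of_two_mul_mem {x : ℝ} (hx : 2 * x ∈ unitInterval) : root.haar x = -1 := by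
  simp [haar_root, hx, two_mul_sub_one_notMem hx]

theorem haar_root_of_two_mul_sub_one_mem {x : ℝ} (hx : 2 * x - 1 ∈ unitInterval) :
    root.haar x = 1 := by
  have : 2 * x ∉ unitInterval := fun hx' => two_mul_sub_one_notMem hx' hx
  simp [haar_root, hx, this]

theorem haar_eq_zero (I : DyadicInterval) {x : ℝ} (hx : x ∉ unitInterval) : I.haar x = 0 := by
  simp only [haar, Set.indicator_of_notMem (mt (@set_subset _ x) hx), sub_zero, mul_zero]

theorem measurable_haar (I : DyadicInterval) : Measurable I.haar :=
  (((measurable_const.indicator I.right.measurableSet_set).sub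
    (measurable_const.indicator I.left.measurableSet_set)).const_mul _)

theorem integral_haar (I : DyadicInterval) : ∫ x, I.haar x = 0 := by
  have integrable_indicator (J : DyadicInterval) : Integrable (J.set.indicator (1 : ℝ → ℝ)) :=
    (integrable_indicator_iff J.measurableSet_set).2 (integrableOn_const (by simp [set]))
  simp only [haar]
  rw [integral_const_mul, integral_sub (integrable_indicator _) (integrable_indicator _),
    integral_indicator_one (measurableSet_set _), integral_indicator_one (measurableSet_set _),
    volume_real_set, volume_real_set]
  simp [left, right, length]

end DyadicInterval

open DyadicInterval

/-! ### Averages and Haar shifts of glued functions -/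

theorem setIntegral_lower_glue (f g : ℝ → ℝ) (I : DyadicInterval) :
    ∫ x in I.lower.set, glue f g x = 1 / 2 * ∫ x in I.set, f x := by
  rw [← integral_indicator (measurableSet_set _), ← integral_indicator (measurableSet_set _),
    ← smul_eq_mul, ← integral_comp_two_mul]
  congr 1 with x
  by_cases hx : 2 * x ∈ I.set
  · rw [Set.indicator_of_mem (mem_set_lower.2 hx), Set.indicator_of_mem hx,
      glue_of_two_mul_mem (I.set_subset hx)]
  · rw [Set.indicator_of_notMem (mt mem_set_lower.1 hx), Set.indicator_of_notMem hx]

theorem setIntegral_upper_glue (f g : ℝ → ℝ) (I : DyadicInterval) :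
    ∫ x in I.upper.set, glue f g x = 1 / 2 * ∫ x in I.set, g x := by
  rw [← integral_indicator (measurableSet_set _), ← integral_indicator (measurableSet_set _),
    ← smul_eq_mul, ← integral_comp_two_mul_sub_one]
  congr 1 with x
  by_cases hx : 2 * x - 1 ∈ I.set
  · rw [Set.indicator_of_mem (mem_set_upper.2 hx), Set.indicator_of_mem hx,
      glue_of_two_mul_sub_one_mem (I.set_subset hx)]
  · rw [Set.indicator_of_notMem (mt mem_set_upper.1 hx), Set.indicator_of_notMem hx]

theorem glue_apply_apply (V W : ℝ → Mat) (x : ℝ) (i j : Fin 2) :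
    glue V W x i j = glue (fun y => V y i j) (fun y => W y i j) x :=
  apply_ite (fun A : Mat => A i j) _ _ _

theorem average_glue_lower (V W : ℝ → Mat) (I : DyadicInterval) :
    average (glue V W) I.lower = average V I := by
  ext i j
  simp only [average, Matrix.of_apply, glue_apply_apply, setIntegral_lower_glue, length_lower]
  field_simp

theorem average_glue_upper (V W : ℝ → Mat) (I : DyadicInterval) :
    average (glue V W) I.upper = average W I := by
  ext i j
  simp only [average, Matrix.of_apply, glue_apply_apply, setIntegral_upper_glue, length_upper]
  field_simp

theorem average_const (A : Mat) (I : DyadicInterval) : average (fun _ => A) I = A := by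
  ext i j
  simp only [average, Matrix.of_apply, setIntegral_const, volume_real_set, smul_eq_mul]
  exact inv_mul_cancel_left₀ I.length_pos.ne' _

theorem average_eval_root (t : DyadicTree Mat) : average t.eval root = t.mean := by
  ext i j
  have entry_eval (x : ℝ) :
      t.eval x i j = (t.map (Matrix.entryLinearMap ℝ ℝ i j)).eval x := by
    rw [DyadicTree.eval_map, Matrix.entryLinearMap_apply]
  simp only [average, Matrix.of_apply, set_root, entry_eval, DyadicTree.setIntegral_eval,
    DyadicTree.mean_map, Matrix.entryLinearMap_apply]
  simp [root, DyadicInterval.length]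

theorem haarCoeff_const (v : Plane) (I : DyadicInterval) : haarCoeff (fun _ => v) I = 0 := by
  rw [haarCoeff, integral_smul_const, integral_haar, zero_smul]

theorem haarCoeff_indicator (f : ℝ → Plane) (I : DyadicInterval) :
    haarCoeff (unitInterval.indicator f) I = haarCoeff f I := by
  unfold haarCoeff
  congr 1 with x : 1
  by_cases hx : x ∈ unitInterval
  · rw [Set.indicator_of_mem hx]
  · rw [haar_eq_zero I hx, zero_smul, zero_smul]

section HaarShift

variable {f g : ℝ → Plane}

theorem haarCoeff_glue_root (hf : IntegrableOn f unitInterval) (hg : IntegrableOn g unitInterval) :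
    haarCoeff (glue f g) root =
      (1 / 2 : ℝ) • ((∫ x in unitInterval, g x) - ∫ x in unitInterval, f x) := by
  have haar_smul (x : ℝ) : root.haar x • glue f g x =
      unitInterval.indicator g (2 * x - 1) - unitInterval.indicator f (2 * x) := by
    rw [haar_root]
    by_cases hx : 2 * x ∈ unitInterval
    · simp [hx, two_mul_sub_one_notMem hx, glue_of_two_mul_mem hx]
    · by_cases hx' : 2 * x - 1 ∈ unitInterval
      · simp [hx, hx', glue_of_two_mul_sub_one_mem hx']
      · simp [hx, hx']
  simp only [← integral_indicator measurableSet_unitInterval]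
  rw [← integrable_indicator_iff measurableSet_unitInterval] at hf hg
  rw [haarCoeff, funext haar_smul, integral_sub (integrable_comp_two_mul_sub_one hg)
    (integrable_comp_two_mul hf), integral_comp_two_mul, integral_comp_two_mul_sub_one, smul_sub]

theorem haarCoeff_glue_lower (f g : ℝ → Plane) (I : DyadicInterval) :
    haarCoeff (glue f g) I.lower = (√2 / 2) • haarCoeff f I := by
  have haar_smul (x : ℝ) : I.lower.haar x • glue f g x =
      √2 • (fun y => I.haar y • f y) (2 * x) := by
    by_cases hx : 2 * x ∈ unitInterval
    · rw [haar_lower, glue_of_two_mul_mem hx, mul_smul]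
    · simp only [haar_lower, haar_eq_zero I hx, mul_zero, zero_smul, smul_zero]
  rw [haarCoeff, funext haar_smul, integral_smul, integral_comp_two_mul fun y => I.haar y • f y,
    smul_smul, haarCoeff, mul_one_div]

theorem haarCoeff_glue_upper (f g : ℝ → Plane) (I : DyadicInterval) :
    haarCoeff (glue f g) I.upper = (√2 / 2) • haarCoeff g I := by
  have haar_smul (x : ℝ) : I.upper.haar x • glue f g x =
      √2 • (fun y => I.haar y • g y) (2 * x - 1) := by
    by_cases hx : 2 * x - 1 ∈ unitInterval
    · rw [haar_upper, glue_of_two_mul_sub_one_mem hx, mul_smul]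
    · simp only [haar_upper, haar_eq_zero I hx, mul_zero, zero_smul, smul_zero]
  rw [haarCoeff, funext haar_smul, integral_smul,
    integral_comp_two_mul_sub_one fun y => I.haar y • g y, smul_smul, haarCoeff, mul_one_div]

theorem hasSum_of_lower_upper {M : Type*} [AddCommMonoid M] [TopologicalSpace M] [ContinuousAdd M]
    {φ : DyadicInterval → M} {a b : M} (ha : HasSum (fun I => φ (lower I)) a)
    (hb : HasSum (fun I => φ (upper I)) b) : HasSum φ (φ root + a + b) := by
  have disjoint_root_lower : Disjoint {root} (Set.range lower) :=
    Set.disjoint_singleton_left.2 fun ⟨I, hI⟩ => lower_ne_root I hI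
  have isCompl_upper : IsCompl ({root} ∪ Set.range lower) (Set.range upper) := by
    refine ⟨Set.disjoint_left.2 ?_, codisjoint_iff_le_sup.2 fun I _ => ?_⟩
    · rintro _ (rfl | ⟨I, rfl⟩) ⟨J, hJ⟩
      exacts [upper_ne_root J hJ, lower_ne_upper I J hJ.symm]
    · rcases I.eq_root_or with rfl | hI | hI
      exacts [Or.inl (Or.inl rfl), Or.inl (Or.inr hI), Or.inr hI]
  exact ((hasSum_unique fun I : ({root} : Set DyadicInterval) => φ I).add_disjoint
    disjoint_root_lower (lower_injective.hasSum_range_iff.2 ha)).add_isCompl isCompl_upper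
    (upper_injective.hasSum_range_iff.2 hb)

theorem hasSum_haarShift (hf : {I | haarCoeff f I ≠ 0}.Finite) (x : ℝ) :
    HasSum (fun I : DyadicInterval => (I.right.haar x - I.left.haar x) • haarCoeff f I)
      (haarShift f x) :=
  (summable_of_hasFiniteSupport (hf.subset fun _ => right_ne_zero_of_smul)).hasSum

theorem stronglyMeasurable_haarShift (hf : {I | haarCoeff f I ≠ 0}.Finite) :
    StronglyMeasurable (haarShift f) := by
  have haarShift_eq : haarShift f = fun x => ∑ I ∈ hf.toFinset,
      (I.right.haar x - I.left.haar x) • haarCoeff f I := by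
    funext x
    refine tsum_eq_sum fun I hI => ?_
    rw [not_not.1 (mt hf.mem_toFinset.2 hI), smul_zero]
  rw [haarShift_eq]
  exact Finset.stronglyMeasurable_fun_sum _ fun I _ =>
    ((measurable_haar _).sub (measurable_haar _)).stronglyMeasurable.smul_const _

theorem haarShift_eq_zero (f : ℝ → Plane) {x : ℝ} (hx : x ∉ unitInterval) :
    haarShift f x = 0 := by
  simp [haarShift, haar_eq_zero _ hx]

theorem haarShift_indicator (f : ℝ → Plane) :
    haarShift (unitInterval.indicator f) = haarShift f := by
  funext x
  simp only [haarShift, haarCoeff_indicator]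

/-- The jump that the Haar coefficient of `[0,1)` causes in the Haar shift, for a function with
average `u` on the left and `v` on the right half. -/
def jump (u v : Plane) : Plane := (√2 / 2) • (v - u)

theorem haarShift_glue (hf : IntegrableOn f unitInterval) (hg : IntegrableOn g unitInterval)
    (hf' : {I | haarCoeff f I ≠ 0}.Finite) (hg' : {I | haarCoeff g I ≠ 0}.Finite) (x : ℝ) :
    haarShift (glue f g) x = (root.haar (2 * x - 1) - root.haar (2 * x)) •
      jump (∫ x in unitInterval, f x) (∫ x in unitInterval, g x) +
        haarShift f (2 * x) + haarShift g (2 * x - 1) := by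
  have sqrt_two_mul : √2 * (√2 / 2) = 1 := by
    rw [← mul_div_assoc, Real.mul_self_sqrt zero_le_two, div_self two_ne_zero]
  have smul_cancel (y : ℝ) (v : Plane) : (√2 * y) • (√2 / 2) • v = y • v := by
    rw [smul_smul, mul_right_comm, sqrt_two_mul, one_mul]
  refine HasSum.tsum_eq ?_
  convert hasSum_of_lower_upper (φ := fun I : DyadicInterval =>
    (I.right.haar x - I.left.haar x) • haarCoeff (glue f g) I) ?_ ?_ using 3
  · simp only [right_root, left_root, haar_upper, haar_lower, haarCoeff_glue_root hf hg, jump,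
      smul_smul]
    congr 1
    ring
  · convert hasSum_haarShift hf' (2 * x) using 2 with I
    rw [right_lower, left_lower, haar_lower, haar_lower, haarCoeff_glue_lower, ← mul_sub,
      smul_cancel]
  · convert hasSum_haarShift hg' (2 * x - 1) using 2 with I
    rw [right_upper, left_upper, haar_upper, haar_upper, haarCoeff_glue_upper, ← mul_sub,
      smul_cancel]

end HaarShift

theorem DyadicTree.finite_haarCoeff_ne_zero (t : DyadicTree Plane) :
    {I | haarCoeff t.eval I ≠ 0}.Finite := by
  induction t with
  | leaf v => simp [eval, haarCoeff_const]
  | node l r ihl ihr =>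
    refine ((Set.finite_singleton root).union ((ihl.image lower).union (ihr.image upper))).subset ?_
    rw [Set.subset_def, DyadicInterval.forall_iff]
    refine ⟨fun _ => Or.inl rfl, fun I hI => Or.inr (Or.inl ⟨I, ?_, rfl⟩),
      fun I hI => Or.inr (Or.inr ⟨I, ?_, rfl⟩)⟩
    · exact right_ne_zero_of_smul ((haarCoeff_glue_lower l.eval r.eval I).symm.trans_ne hI)
    · exact right_ne_zero_of_smul ((haarCoeff_glue_upper l.eval r.eval I).symm.trans_ne hI)

theorem DyadicTree.haarShift_eval_leaf (v : Plane) (x : ℝ) :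
    haarShift (leaf v).eval x = 0 := by
  simp [haarShift, eval, haarCoeff_const]

theorem DyadicTree.haarShift_eval_node (l r : DyadicTree Plane) (x : ℝ) :
    haarShift (node l r).eval x = (root.haar (2 * x - 1) - root.haar (2 * x)) •
      jump l.mean r.mean + haarShift l.eval (2 * x) + haarShift r.eval (2 * x - 1) := by
  rw [eval, haarShift_glue l.integrableOn_eval r.integrableOn_eval l.finite_haarCoeff_ne_zero
    r.finite_haarCoeff_ne_zero, l.setIntegral_eval, r.setIntegral_eval]

/-! ### The energy of the Haar shift -/

/-- The vector `A e` as a linear function of the matrix `A`. -/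
def actAt (e : Plane) : Mat →ₗ[ℝ] Plane where
  toFun A := act A e
  map_add' A B := by simp only [act, Matrix.add_mulVec, WithLp.toLp_add]
  map_smul' c A := by simp only [act, Matrix.smul_mulVec, WithLp.toLp_smul, RingHom.id_apply]

theorem act_mul (A B : Mat) (x : Plane) : act (A * B) x = act A (act B x) := by
  simp only [act, Matrix.mulVec_mulVec]

theorem act_one (x : Plane) : act 1 x = x := by simp only [act, Matrix.one_mulVec]

/-- The quadratic form of a matrix. -/
def quad (A : Mat) (g : Plane) : ℝ := ⟪act A g, g⟫_ℝ

theorem quad_nonneg {A : Mat} (hA : A.PosSemidef) (g : Plane) : 0 ≤ quad A g := by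
  have : quad A g = dotProduct g.ofLp (A.mulVec g.ofLp) := by
    simp [quad, act, EuclideanSpace.inner_eq_star_dotProduct]
  simpa [this] using hA.dotProduct_mulVec_nonneg g.ofLp

namespace DyadicTree

variable {t : DyadicTree Mat}

/-- The average of the inverse of a matrix step function. -/
def meanInv (t : DyadicTree Mat) : Mat := (t.map fun A => A⁻¹).mean

/-- The step function `W⁻¹ e`, where `W` is the step function of the tree. -/
def invAct (t : DyadicTree Mat) (e : Plane) : DyadicTree Plane := t.map fun A => act A⁻¹ e

/-- The integral of `(W g, g)` over `[0,1)`, where `W` is the step function of the tree,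
`g = G + h • P + Ш (W⁻¹ e)` and `h` is the Haar function of `[0,1)`. -/
def energy (e : Plane) : DyadicTree Mat → Plane → Plane → ℝ
  | leaf A, G, P => 1 / 2 * (quad A (G - P) + quad A (G + P))
  | node l r, G, P =>
    1 / 2 * (energy e l (G - P) (-jump (act l.meanInv e) (act r.meanInv e)) +
      energy e r (G + P) (jump (act l.meanInv e) (act r.meanInv e)))

theorem eval_invAct (t : DyadicTree Mat) (e : Plane) :
    (t.invAct e).eval = fun x => act (t.eval x)⁻¹ e := funext (t.eval_map _)

theorem eval_inv (t : DyadicTree Mat) :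
    (t.map fun A => A⁻¹).eval = fun x => (t.eval x)⁻¹ := funext (t.eval_map _)

theorem meanInv_node (l r : DyadicTree Mat) :
    (node l r).meanInv = (1 / 2 : ℝ) • (l.meanInv + r.meanInv) := rfl

theorem mean_invAct (t : DyadicTree Mat) (e : Plane) :
    (t.invAct e).mean = act t.meanInv e := by
  have : t.invAct e = (t.map fun A => A⁻¹).map (actAt e) := by
    rw [map_map]
    rfl
  rw [this, mean_map]
  rfl

theorem mean_inner_invAct (t : DyadicTree Mat) (e : Plane) :
    ((t.invAct e).map (innerₛₗ ℝ e)).mean = ⟪e, act t.meanInv e⟫_ℝ := by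
  rw [mean_map, mean_invAct, innerₛₗ_apply_apply]

theorem mul_inner_sq_le_half_add {c : ℝ} (hc : 0 ≤ c) (b G P : Plane) :
    c * ⟪b, G⟫_ℝ ^ 2 ≤ 1 / 2 * (c * ⟪b, G - P⟫_ℝ ^ 2 + c * ⟪b, G + P⟫_ℝ ^ 2) := by
  rw [inner_sub_right, inner_add_right]
  nlinarith [mul_nonneg hc (sq_nonneg ⟪b, P⟫_ℝ)]

/-- Jensen's inequality: the function whose energy is taken has average `G`. -/
theorem mul_inner_sq_le_energy {c : ℝ} (hc : 0 ≤ c) {b : Plane} (e : Plane)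
    (ht : t.All fun A => ∀ g, c * ⟪b, g⟫_ℝ ^ 2 ≤ quad A g) (G P : Plane) :
    c * ⟪b, G⟫_ℝ ^ 2 ≤ energy e t G P := by
  induction t generalizing G P with
  | leaf A =>
    refine (mul_inner_sq_le_half_add hc b G P).trans ?_
    exact mul_le_mul_of_nonneg_left (add_le_add (ht _) (ht _)) (by norm_num)
  | node l r ihl ihr =>
    refine (mul_inner_sq_le_half_add hc b G P).trans ?_
    exact mul_le_mul_of_nonneg_left (add_le_add (ihl ht.1 _ _) (ihr ht.2 _ _)) (by norm_num)

theorem energy_nonneg (ht : t.All Matrix.PosSemidef) (e G P : Plane) : 0 ≤ energy e t G P := by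
  simpa using mul_inner_sq_le_energy le_rfl (b := 0) e
    (ht.imp fun A hA g => by simpa using quad_nonneg hA g) G P

theorem haarShift_invAct_leaf (A : Mat) (e : Plane) (x : ℝ) :
    haarShift ((leaf A).invAct e).eval x = 0 := haarShift_eval_leaf _ x

theorem haarShift_invAct_node_of_two_mul_mem (l r : DyadicTree Mat) (e : Plane) {x : ℝ}
    (hx : 2 * x ∈ unitInterval) : haarShift ((node l r).invAct e).eval x =
      root.haar (2 * x) • -jump (act l.meanInv e) (act r.meanInv e) +
        haarShift (l.invAct e).eval (2 * x) := by
  have hx' := two_mul_sub_one_notMem hx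
  rw [invAct, map, haarShift_eval_node, haarShift_eq_zero _ hx', haar_eq_zero _ hx', zero_sub,
    add_zero, neg_smul, ← smul_neg, ← mean_invAct, ← mean_invAct]
  rfl

theorem haarShift_invAct_node_of_two_mul_sub_one_mem (l r : DyadicTree Mat) (e : Plane) {x : ℝ}
    (hx : 2 * x - 1 ∈ unitInterval) : haarShift ((node l r).invAct e).eval x =
      root.haar (2 * x - 1) • jump (act l.meanInv e) (act r.meanInv e) +
        haarShift (r.invAct e).eval (2 * x - 1) := by
  have hx' : 2 * x ∉ unitInterval := fun hx' => two_mul_sub_one_notMem hx' hx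
  rw [invAct, map, haarShift_eval_node, haarShift_eq_zero _ hx', haar_eq_zero _ hx', sub_zero,
    add_zero, ← mean_invAct, ← mean_invAct]
  rfl

/-- The integrand whose integral over `[0,1)` is `energy e t G P`. -/
def energyDensity (e : Plane) (t : DyadicTree Mat) (G P : Plane) (x : ℝ) : ℝ :=
  quad (t.eval x) (G + root.haar x • P + haarShift (t.invAct e).eval x)

theorem energyDensity_leaf_eqOn (e : Plane) (A : Mat) (G P : Plane) :
    Set.EqOn (energyDensity e (leaf A) G P)
      (glue (fun _ => quad A (G - P)) fun _ => quad A (G + P)) unitInterval := by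
  refine eqOn_glue (fun x hx => ?_) fun x hx => ?_
  · rw [energyDensity, haarShift_invAct_leaf, haar_root_of_two_mul_mem hx, neg_one_smul,
      ← sub_eq_add_neg, add_zero, eval]
  · rw [energyDensity, haarShift_invAct_leaf, haar_root_of_two_mul_sub_one_mem hx, one_smul,
      add_zero, eval]

theorem energyDensity_node_eqOn (e : Plane) (l r : DyadicTree Mat) (G P : Plane) :
    Set.EqOn (energyDensity e (node l r) G P)
      (glue (energyDensity e l (G - P) (-jump (act l.meanInv e) (act r.meanInv e)))
        (energyDensity e r (G + P) (jump (act l.meanInv e) (act r.meanInv e)))) unitInterval := by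
  refine eqOn_glue (fun x hx => ?_) fun x hx => ?_
  · rw [energyDensity, energyDensity, haarShift_invAct_node_of_two_mul_mem l r e hx, eval,
      glue_of_two_mul_mem hx, haar_root_of_two_mul_mem hx, neg_one_smul, ← sub_eq_add_neg,
      ← add_assoc]
  · rw [energyDensity, energyDensity, haarShift_invAct_node_of_two_mul_sub_one_mem l r e hx, eval,
      glue_of_two_mul_sub_one_mem hx, haar_root_of_two_mul_sub_one_mem hx, one_smul, ← add_assoc]

theorem integrableOn_energyDensity (e : Plane) (t : DyadicTree Mat) (G P : Plane) :
    IntegrableOn (energyDensity e t G P) unitInterval := by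
  induction t generalizing G P with
  | leaf A =>
    exact (integrableOn_glue (leaf _).integrableOn_eval (leaf _).integrableOn_eval).congr_fun
      (energyDensity_leaf_eqOn e A G P).symm measurableSet_unitInterval
  | node l r ihl ihr =>
    exact (integrableOn_glue (ihl _ _) (ihr _ _)).congr_fun
      (energyDensity_node_eqOn e l r G P).symm measurableSet_unitInterval

theorem setIntegral_energyDensity (e : Plane) (t : DyadicTree Mat) (G P : Plane) :
    ∫ x in unitInterval, energyDensity e t G P x = energy e t G P := by
  induction t generalizing G P with
  | leaf A =>
    rw [setIntegral_congr_fun measurableSet_unitInterval (energyDensity_leaf_eqOn e A G P)]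
    exact (node (leaf _) (leaf _)).setIntegral_eval
  | node l r ihl ihr =>
    rw [setIntegral_congr_fun measurableSet_unitInterval (energyDensity_node_eqOn e l r G P),
      setIntegral_glue (l.integrableOn_energyDensity e _ _) (r.integrableOn_energyDensity e _ _),
      ihl, ihr, energy, smul_eq_mul]

/-! ### Matrix weights given by trees -/

theorem isMatrixWeight_eval (ht : t.All Matrix.PosSemidef) : IsMatrixWeight t.eval := by
  refine ⟨fun x _ => ht.eval x, fun i j => ?_⟩
  have := (t.map (Matrix.entryLinearMap ℝ ℝ i j)).integrableOn_eval
  rwa [funext (t.eval_map _)] at this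

theorem testFunction_eval (t : DyadicTree Mat) (e : Plane) :
    testFunction t.eval e = unitInterval.indicator (t.invAct e).eval := by
  rw [eval_invAct, testFunction]

theorem haarShift_testFunction (t : DyadicTree Mat) (e : Plane) :
    haarShift (testFunction t.eval e) = haarShift (t.invAct e).eval := by
  rw [testFunction_eval, haarShift_indicator]

theorem finite_haarCoeff_testFunction_ne_zero (t : DyadicTree Mat) (e : Plane) :
    {I | haarCoeff (testFunction t.eval e) I ≠ 0}.Finite := by
  simp only [testFunction_eval, haarCoeff_indicator]
  exact (t.invAct e).finite_haarCoeff_ne_zero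

theorem quad_testFunction (ht : t.All Matrix.PosDef) (e : Plane) {x : ℝ} (hx : x ∈ unitInterval) :
    quad (t.eval x) (testFunction t.eval e x) = ((t.invAct e).map (innerₛₗ ℝ e)).eval x := by
  have := (Matrix.isUnit_iff_isUnit_det _).1 (ht.eval x).isUnit
  rw [testFunction, Set.indicator_of_mem hx, quad, ← act_mul, Matrix.mul_nonsing_inv _ this,
    act_one, eval_map, eval_invAct, innerₛₗ_apply_apply]

theorem memL2_testFunction (ht : t.All Matrix.PosDef) (e : Plane) :
    MemL2 t.eval (testFunction t.eval e) := by
  refine ⟨?_, ((t.invAct e).map (innerₛₗ ℝ e)).integrableOn_eval.congr_fun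
    (fun x hx => (quad_testFunction ht e hx).symm) measurableSet_unitInterval⟩
  rw [testFunction_eval]
  exact ((t.invAct e).stronglyMeasurable_eval.indicator
    measurableSet_unitInterval).aestronglyMeasurable

theorem normL2_testFunction (ht : t.All Matrix.PosDef) (e : Plane) :
    normL2 t.eval (testFunction t.eval e) = √⟪e, act t.meanInv e⟫_ℝ := by
  rw [← mean_inner_invAct, ← setIntegral_eval,
    ← setIntegral_congr_fun measurableSet_unitInterval fun x hx => quad_testFunction ht e hx]
  rfl

theorem quad_haarShift_testFunction (t : DyadicTree Mat) (e : Plane) :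
    (fun x => quad (t.eval x) (haarShift (testFunction t.eval e) x)) = energyDensity e t 0 0 := by
  funext x
  rw [haarShift_testFunction, energyDensity, smul_zero, add_zero, zero_add]

theorem memL2_haarShift_testFunction (t : DyadicTree Mat) (e : Plane) :
    MemL2 t.eval (haarShift (testFunction t.eval e)) := by
  refine ⟨(stronglyMeasurable_haarShift
    (t.finite_haarCoeff_testFunction_ne_zero e)).aestronglyMeasurable, ?_⟩
  change IntegrableOn (fun x => quad (t.eval x) (haarShift (testFunction t.eval e) x)) _ _
  rw [quad_haarShift_testFunction]
  exact t.integrableOn_energyDensity e 0 0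

theorem normL2_haarShift_testFunction (t : DyadicTree Mat) (e : Plane) :
    normL2 t.eval (haarShift (testFunction t.eval e)) = √(energy e t 0 0) := by
  rw [← setIntegral_energyDensity, ← quad_haarShift_testFunction]
  rfl

end DyadicTree

/-! ### Principal axes and rotations -/

theorem act_diagMat (a b : Plane) (x y : ℝ) (g : Plane) :
    act (diagMat a b x y) g = (x * ⟪a, g⟫_ℝ) • a + (y * ⟪b, g⟫_ℝ) • b := by
  ext i
  simp only [act, diagMat, Matrix.mulVec, dotProduct, Matrix.add_apply, Matrix.smul_apply,
    Matrix.vecMulVec_apply, PiLp.add_apply, PiLp.smul_apply, smul_eq_mul, PiLp.inner_apply,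
    RCLike.inner_apply, conj_trivial, Fin.sum_univ_two]
  ring

theorem quad_diagMat (a b : Plane) (x y : ℝ) (g : Plane) :
    quad (diagMat a b x y) g = x * ⟪a, g⟫_ℝ ^ 2 + y * ⟪b, g⟫_ℝ ^ 2 := by
  rw [quad, act_diagMat, inner_add_left, real_inner_smul_left, real_inner_smul_left]
  ring

theorem half_smul_diagMat_add (a b : Plane) (x y x' y' : ℝ) :
    (1 / 2 : ℝ) • (diagMat a b x y + diagMat a b x' y') =
      diagMat a b ((x + x') / 2) ((y + y') / 2) := by
  simp only [diagMat]
  module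

theorem posSemidef_diagMat (a b : Plane) {x y : ℝ} (hx : 0 ≤ x) (hy : 0 ≤ y) :
    (diagMat a b x y).PosSemidef := by
  have posSemidef_vecMulVec (v : Plane) : (Matrix.vecMulVec v.ofLp v.ofLp).PosSemidef := by
    simpa using Matrix.posSemidef_vecMulVec_self_star (R := ℝ) v.ofLp
  exact ((posSemidef_vecMulVec a).smul hx).add ((posSemidef_vecMulVec b).smul hy)

theorem inner_eq_dotProduct (x y : Plane) : ⟪x, y⟫_ℝ = x.ofLp ⬝ᵥ y.ofLp := by
  rw [EuclideanSpace.inner_eq_star_dotProduct, star_trivial, dotProduct_comm]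

/-- `a`, `b` is an orthonormal basis of the plane. -/
structure Axes (a b : Plane) : Prop where
  inner_left_left : ⟪a, a⟫_ℝ = 1
  inner_right_right : ⟪b, b⟫_ℝ = 1
  inner_left_right : ⟪a, b⟫_ℝ = 0

theorem axes_orthonormalBasis (u : OrthonormalBasis (Fin 2) ℝ Plane) : Axes (u 0) (u 1) := by
  constructor <;> simp [u.inner_eq_ite]

namespace Axes

variable {a b : Plane}

theorem inner_right_left (h : Axes a b) : ⟪b, a⟫_ℝ = 0 := by
  rw [real_inner_comm, h.inner_left_right]

theorem diagMat_mul_diagMat (h : Axes a b) (x y x' y' : ℝ) :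
    diagMat a b x y * diagMat a b x' y' = diagMat a b (x * x') (y * y') := by
  have aa := inner_eq_dotProduct a a ▸ h.inner_left_left
  have bb := inner_eq_dotProduct b b ▸ h.inner_right_right
  have ab := inner_eq_dotProduct a b ▸ h.inner_left_right
  have ba := inner_eq_dotProduct b a ▸ h.inner_right_left
  simp [diagMat, add_mul, mul_add, Matrix.vecMulVec_mul_vecMulVec, aa, bb, ab, ba, smul_smul,
    mul_comm]

open scoped Matrix in
theorem diagMat_one_one (h : Axes a b) : diagMat a b 1 1 = 1 := by
  have aa := inner_eq_dotProduct a a ▸ h.inner_left_left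
  have bb := inner_eq_dotProduct b b ▸ h.inner_right_right
  have ab := inner_eq_dotProduct a b ▸ h.inner_left_right
  have ba := inner_eq_dotProduct b a ▸ h.inner_right_left
  have rows_orthonormal : (Matrix.of ![a.ofLp, b.ofLp] : Mat) * (Matrix.of ![a.ofLp, b.ofLp])ᵀ =
      1 := by
    ext i j
    fin_cases i <;> fin_cases j
    exacts [aa, ab, ba, bb]
  rw [← mul_eq_one_comm.1 rows_orthonormal]
  ext i j
  simp [Matrix.mul_apply, Fin.sum_univ_two, diagMat, Matrix.vecMulVec_apply]

theorem inner_self (h : Axes a b) (g : Plane) : ⟪g, g⟫_ℝ = ⟪a, g⟫_ℝ ^ 2 + ⟪b, g⟫_ℝ ^ 2 := by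
  have := quad_diagMat a b 1 1 g
  rwa [h.diagMat_one_one, quad, act_one, one_mul, one_mul] at this

theorem diagMat_self (h : Axes a b) (x : ℝ) : diagMat a b x x = x • (1 : Mat) := by
  rw [← h.diagMat_one_one]
  simp [diagMat]

theorem diagMat_inv (h : Axes a b) {x y : ℝ} (hx : x ≠ 0) (hy : y ≠ 0) :
    (diagMat a b x y)⁻¹ = diagMat a b x⁻¹ y⁻¹ := by
  refine Matrix.inv_eq_right_inv ?_
  rw [h.diagMat_mul_diagMat, mul_inv_cancel₀ hx, mul_inv_cancel₀ hy, h.diagMat_one_one]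

theorem posDef_diagMat (h : Axes a b) {x y : ℝ} (hx : 0 < x) (hy : 0 < y) :
    (diagMat a b x y).PosDef := by
  rw [Matrix.PosSemidef.posDef_iff_isUnit (posSemidef_diagMat a b hx.le hy.le)]
  refine IsUnit.of_mul_eq_one (diagMat a b x⁻¹ y⁻¹) ?_
  rw [h.diagMat_mul_diagMat, mul_inv_cancel₀ hx.ne', mul_inv_cancel₀ hy.ne', h.diagMat_one_one]

open scoped MatrixOrder in
theorem sqrtMat_diagMat (h : Axes a b) {x y : ℝ} (hx : 0 ≤ x) (hy : 0 ≤ y) :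
    sqrtMat (diagMat a b x y) = diagMat a b √x √y := by
  refine CFC.sqrt_unique ?_
    (posSemidef_diagMat a b (Real.sqrt_nonneg x) (Real.sqrt_nonneg y)).nonneg
  rw [h.diagMat_mul_diagMat, Real.mul_self_sqrt hx, Real.mul_self_sqrt hy]

theorem opNorm_sqrtMat_mul_sqrtMat_sq (h : Axes a b) {x y x' y' K : ℝ} (hx : 0 ≤ x) (hy : 0 ≤ y)
    (hx' : 0 ≤ x') (hy' : 0 ≤ y') (hxx' : x * x' = K) (hyy' : y * y' = K) :
    opNorm (sqrtMat (diagMat a b x y) * sqrtMat (diagMat a b x' y')) ^ 2 = K := by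
  have hK : 0 ≤ K := hxx' ▸ mul_nonneg hx hx'
  rw [h.sqrtMat_diagMat hx hy, h.sqrtMat_diagMat hx' hy', h.diagMat_mul_diagMat, ← Real.sqrt_mul hx,
    ← Real.sqrt_mul hy, hxx', hyy', h.diagMat_self, opNorm, map_smul, map_one, norm_smul, norm_one,
    mul_one, Real.norm_eq_abs, sq_abs, Real.sq_sqrt hK]

end Axes

/-- The normalizing factor `(1+δ²)^{-1/2}` of `turn δ`. -/
def lam (δ : ℝ) : ℝ := (√(1 + δ ^ 2))⁻¹

theorem lam_neg (δ : ℝ) : lam (-δ) = lam δ := by rw [lam, lam, neg_sq]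

theorem lam_sq_mul (δ : ℝ) : lam δ ^ 2 * (1 + δ ^ 2) = 1 := by
  rw [lam, inv_pow, Real.sq_sqrt (by positivity), inv_mul_cancel₀ (by positivity)]

theorem lam_pos (δ : ℝ) : 0 < lam δ := inv_pos.2 (Real.sqrt_pos.2 (by positivity))

theorem lam_le_one (δ : ℝ) : lam δ ≤ 1 :=
  inv_le_one_of_one_le₀ (Real.one_le_sqrt.2 (le_add_of_nonneg_right (sq_nonneg δ)))

theorem one_sub_half_sq_le_lam (δ : ℝ) : 1 - δ ^ 2 / 2 ≤ lam δ := by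
  calc 1 - δ ^ 2 / 2 ≤ (1 + δ ^ 2 / 2)⁻¹ := by
        rw [← one_div, le_div_iff₀ (by positivity)]
        linarith [sq_nonneg (δ ^ 2)]
    _ ≤ lam δ := inv_anti₀ (by positivity) (Real.sqrt_one_add_le (by linarith [sq_nonneg δ]))

theorem inner_turn_left (δ : ℝ) (u v g : Plane) :
    ⟪turn δ u v, g⟫_ℝ = lam δ * (⟪u, g⟫_ℝ + δ * ⟪v, g⟫_ℝ) := by
  rw [turn, real_inner_smul_left, inner_add_left, real_inner_smul_left, lam]

theorem inner_turn_right (δ : ℝ) (u v g : Plane) :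
    ⟪g, turn δ u v⟫_ℝ = lam δ * (⟪g, u⟫_ℝ + δ * ⟪g, v⟫_ℝ) := by
  rw [real_inner_comm, inner_turn_left, real_inner_comm, real_inner_comm g]

theorem diagMat_turn_add (a b : Plane) (δ x y : ℝ) :
    (1 / 2 : ℝ) • (diagMat (turn (-δ) a b) (turn δ b a) x y +
      diagMat (turn δ a b) (turn (-δ) b a) x y) =
      diagMat a b (lam δ ^ 2 * (x + δ ^ 2 * y)) (lam δ ^ 2 * (y + δ ^ 2 * x)) := by
  ext i j
  simp only [diagMat, Matrix.add_apply, Matrix.smul_apply, Matrix.vecMulVec_apply, smul_eq_mul,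
    turn, lam, PiLp.smul_apply, PiLp.add_apply, neg_sq]
  ring

namespace Axes

variable {a b : Plane}

theorem turn_pos (h : Axes a b) (δ : ℝ) : Axes (turn δ a b) (turn (-δ) b a) := by
  have lam_sq_mul := lam_sq_mul δ
  constructor <;>
    simp only [inner_turn_left, inner_turn_right, h.inner_left_left, h.inner_right_right,
      h.inner_left_right, h.inner_right_left, lam_neg]
  · linear_combination lam_sq_mul
  · linear_combination lam_sq_mul
  · ring

theorem turn_neg (h : Axes a b) (δ : ℝ) : Axes (turn (-δ) a b) (turn δ b a) := by
  simpa only [neg_neg] using h.turn_pos (-δ)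

end Axes

/-! ### The eigenvalues -/

theorem le_stretch {Q : ℝ} (hQ : 10 ≤ Q) : 19 / 10 ≤ stretch Q := by
  have : 1 / Q ≤ 1 / 10 := one_div_le_one_div_of_le (by norm_num) hQ
  rw [stretch]
  linarith

theorem two_sub_stretch (Q : ℝ) : 2 - stretch Q = 1 / Q := sub_sub_cancel _ _

namespace Eig

/-- The averages `β# a a* + α# b b*` and `α a a* + β b b*` of `W` and `W⁻¹` are positive definite
and their product is `K` times the identity. -/
structure Balanced (K : ℝ) (p : Eig) : Prop where
  al_pos : 0 < p.al
  be_pos : 0 < p.be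
  alS_pos : 0 < p.alS
  beS_pos : 0 < p.beS
  al_mul_beS : p.al * p.beS = K
  be_mul_alS : p.be * p.alS = K

/-- The properties of the eigenvalues on stopping intervals; `D = α β` is the same number for all of
them. -/
structure Stopping (Q D : ℝ) (p : Eig) : Prop where
  al_pos : 0 < p.al
  be_pos : 0 < p.be
  be_le_al : p.be ≤ p.al
  al_mul_be : p.al * p.be = D
  alS_eq : p.alS = Q / D * p.al
  beS_eq : p.beS = Q / D * p.be

namespace Stopping

variable {Q D : ℝ} {p : Eig}

theorem pos (h : p.Stopping Q D) : 0 < D := h.al_mul_be ▸ mul_pos h.al_pos h.be_pos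

theorem balanced (h : p.Stopping Q D) (hQ : 0 < Q) : p.Balanced Q where
  al_pos := h.al_pos
  be_pos := h.be_pos
  alS_pos := h.alS_eq ▸ mul_pos (div_pos hQ h.pos) h.al_pos
  beS_pos := h.beS_eq ▸ mul_pos (div_pos hQ h.pos) h.be_pos
  al_mul_beS := by
    rw [h.beS_eq, mul_left_comm, h.al_mul_be, div_mul_cancel₀ _ h.pos.ne']
  be_mul_alS := by
    rw [h.alS_eq, mul_left_comm, mul_comm p.be, h.al_mul_be, div_mul_cancel₀ _ h.pos.ne']

theorem delta_pos (h : p.Stopping Q D) : 0 < p.delta :=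
  mul_pos (by norm_num [q]) (Real.sqrt_pos.2 (div_pos h.be_pos h.al_pos))

theorem be_eq (h : p.Stopping Q D) : p.be = 100 * p.delta ^ 2 * p.al := by
  have al_pos := h.al_pos
  rw [delta, mul_pow, Real.sq_sqrt (div_nonneg h.be_pos.le al_pos.le), q]
  field_simp
  norm_num

theorem delta_sq_le (h : p.Stopping Q D) : p.delta ^ 2 ≤ 1 / 100 := by
  have : 100 * p.delta ^ 2 * p.al ≤ 1 * p.al := by rw [← h.be_eq, one_mul]; exact h.be_le_al
  linarith [le_of_mul_le_mul_right this h.al_pos]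

theorem al_mul_delta (h : p.Stopping Q D) : p.al * p.delta = √D / 10 := by
  have sq_eq : D = (10 * (p.al * p.delta)) ^ 2 := by rw [← h.al_mul_be, h.be_eq]; ring
  rw [sq_eq, Real.sqrt_sq (by have := h.al_pos; have := h.delta_pos; positivity)]
  ring

theorem rotated_al (h : p.Stopping Q D) :
    p.rotated.al = (1 - 100 * (p.delta ^ 2) ^ 2) / (1 - p.delta ^ 2) * p.al := by
  rw [rotated, h.be_eq]
  ring

theorem rotated_be (h : p.Stopping Q D) :
    p.rotated.be = 99 / 100 / (1 - p.delta ^ 2) * p.be := by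
  rw [rotated, h.be_eq]
  ring

theorem rotated_alS (h : p.Stopping Q D) : p.rotated.alS = Q / D * p.rotated.al := by
  rw [rotated, h.alS_eq, h.beS_eq]
  ring

theorem rotated_beS (h : p.Stopping Q D) : p.rotated.beS = Q / D * p.rotated.be := by
  rw [rotated, h.alS_eq, h.beS_eq]
  ring

theorem one_sub_delta_sq_pos (h : p.Stopping Q D) : 0 < 1 - p.delta ^ 2 := by
  linarith [h.delta_sq_le]

theorem al_le_rotated_al (h : p.Stopping Q D) : p.al ≤ p.rotated.al := by
  rw [h.rotated_al]
  refine le_mul_of_one_le_left h.al_pos.le ((one_le_div h.one_sub_delta_sq_pos).2 ?_)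
  nlinarith [h.delta_sq_le, sq_nonneg p.delta]

theorem rotated_al_le (h : p.Stopping Q D) : p.rotated.al ≤ 2 * p.al := by
  rw [h.rotated_al]
  refine mul_le_mul_of_nonneg_right ((div_le_iff₀ h.one_sub_delta_sq_pos).2 ?_) h.al_pos.le
  linarith [h.delta_sq_le, sq_nonneg (p.delta ^ 2)]

theorem rotated_al_pos (h : p.Stopping Q D) : 0 < p.rotated.al :=
  h.al_pos.trans_le h.al_le_rotated_al

theorem rotated_be_pos (h : p.Stopping Q D) : 0 < p.rotated.be := by
  rw [h.rotated_be]
  exact mul_pos (div_pos (by norm_num) h.one_sub_delta_sq_pos) h.be_pos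

theorem rotated_be_le_rotated_al (h : p.Stopping Q D) : p.rotated.be ≤ p.rotated.al := by
  refine div_le_div_of_nonneg_right ?_ h.one_sub_delta_sq_pos.le
  nlinarith [h.be_le_al, sq_nonneg p.delta]

theorem ratio_eq (h : p.Stopping Q D) (hQ : 0 < Q) :
    p.ratio Q = p.rotated.al * p.rotated.be / D := by
  rw [ratio, h.rotated_beS]
  field_simp

theorem ratio_eq_delta (h : p.Stopping Q D) (hQ : 0 < Q) :
    p.ratio Q = 99 / 100 * (1 - 100 * (p.delta ^ 2) ^ 2) / (1 - p.delta ^ 2) ^ 2 := by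
  have := h.one_sub_delta_sq_pos.ne'
  have := h.al_pos.ne'
  have := h.be_pos.ne'
  rw [h.ratio_eq hQ, h.rotated_al, h.rotated_be, ← h.al_mul_be]
  field_simp

theorem ratio_le_one (h : p.Stopping Q D) (hQ : 0 < Q) : p.ratio Q ≤ 1 := by
  have := h.one_sub_delta_sq_pos
  rw [h.ratio_eq_delta hQ, div_le_one (by positivity)]
  nlinarith [sq_nonneg (1 - 100 * p.delta ^ 2)]

theorem le_ratio (h : p.Stopping Q D) (hQ : 0 < Q) : 98 / 100 ≤ p.ratio Q := by
  have := h.one_sub_delta_sq_pos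
  rw [h.ratio_eq_delta hQ, le_div_iff₀ (by positivity)]
  nlinarith [h.delta_sq_le, sq_nonneg p.delta]

theorem rotated_balanced (h : p.Stopping Q D) (hQ : 0 < Q) :
    p.rotated.Balanced (p.ratio Q * Q) where
  al_pos := h.rotated_al_pos
  be_pos := h.rotated_be_pos
  alS_pos := h.rotated_alS ▸ mul_pos (div_pos hQ h.pos) h.rotated_al_pos
  beS_pos := h.rotated_beS ▸ mul_pos (div_pos hQ h.pos) h.rotated_be_pos
  al_mul_beS := by rw [h.ratio_eq hQ, h.rotated_beS]; ring
  be_mul_alS := by rw [h.ratio_eq hQ, h.rotated_alS]; ring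

theorem le_ratio_mul_stretch (h : p.Stopping Q D) (hQ : 10 ≤ Q) :
    9 / 5 ≤ p.ratio Q * stretch Q := by
  have := mul_le_mul (h.le_ratio (by linarith)) (le_stretch hQ) (by norm_num)
    ((by norm_num : (0 : ℝ) ≤ 98 / 100).trans (h.le_ratio (by linarith)))
  linarith

theorem next_be (h : p.Stopping Q D) (hQ : 10 ≤ Q) : (p.next Q).be = D / (p.next Q).al := by
  have := h.rotated_al_pos
  have := h.rotated_be_pos
  have := h.pos
  have := le_stretch hQ
  simp only [Eig.next, h.ratio_eq (by linarith : 0 < Q)]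
  field_simp

theorem al_mul_stretch_le (h : p.Stopping Q D) (hQ : 10 ≤ Q) :
    p.al * stretch Q ≤ (p.next Q).al := by
  rw [Eig.next, mul_comm]
  exact mul_le_mul_of_nonneg_left h.al_le_rotated_al (by linarith [le_stretch hQ])

theorem next (h : p.Stopping Q D) (hQ : 10 ≤ Q) : (p.next Q).Stopping Q D := by
  have al_le : p.al ≤ (p.next Q).al := by
    nlinarith [h.al_mul_stretch_le hQ, le_stretch hQ, h.al_pos]
  have al_pos : 0 < (p.next Q).al := h.al_pos.trans_le al_le
  refine ⟨al_pos, h.next_be hQ ▸ div_pos h.pos al_pos, ?_, ?_, ?_, ?_⟩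
  · rw [h.next_be hQ, div_le_iff₀ al_pos, ← h.al_mul_be]
    exact mul_le_mul al_le (h.be_le_al.trans al_le) h.be_pos.le al_pos.le
  · rw [h.next_be hQ, mul_div_cancel₀ _ al_pos.ne']
  · simp only [Eig.next, h.rotated_alS]
    ring
  · simp only [Eig.next, h.rotated_beS]
    ring

theorem next_delta_le (h : p.Stopping Q D) (hQ : 10 ≤ Q) :
    (p.next Q).delta ≤ 3 / 5 * p.delta := by
  have al_le : 19 / 10 * p.al ≤ (p.next Q).al := by
    nlinarith [h.al_mul_stretch_le hQ, le_stretch hQ, h.al_pos]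
  have next_delta_pos := (h.next hQ).delta_pos
  have : p.al * (19 / 10 * (p.next Q).delta) ≤ p.al * p.delta := by
    rw [h.al_mul_delta, ← (h.next hQ).al_mul_delta]
    nlinarith
  linarith [le_of_mul_le_mul_left this h.al_pos, h.delta_pos]

theorem terminal_alS (h : p.Stopping Q D) (hQ : 0 < Q) :
    (p.terminal Q).alS = p.rotated.al / D := by
  rw [Eig.terminal, two_sub_stretch, h.rotated_alS]
  field_simp

theorem terminal_balanced (h : p.Stopping Q D) (hQ : 10 ≤ Q) :
    (p.terminal Q).Balanced (2 * p.ratio Q - 1 / stretch Q) := by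
  have Q_pos : 0 < Q := by linarith
  have stretch_pos : 0 < stretch Q := by linarith [le_stretch hQ]
  have rotated := h.rotated_balanced Q_pos
  have ratio_pos : 0 < p.ratio Q := by linarith [h.le_ratio Q_pos]
  have factor_pos : 0 < 2 - 1 / (p.ratio Q * stretch Q) := by
    have := one_div_le_one_div_of_le (by norm_num) (h.le_ratio_mul_stretch hQ)
    linarith
  have product_eq : 1 / Q * (2 - 1 / (p.ratio Q * stretch Q)) * (p.ratio Q * Q) =
      2 * p.ratio Q - 1 / stretch Q := by
    field_simp
  rw [Eig.terminal, two_sub_stretch]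
  refine ⟨mul_pos (by positivity) rotated.al_pos, mul_pos factor_pos rotated.be_pos,
    mul_pos (by positivity) rotated.alS_pos, mul_pos factor_pos rotated.beS_pos, ?_, ?_⟩
  · rw [mul_mul_mul_comm, rotated.al_mul_beS, product_eq]
  · rw [mul_mul_mul_comm, rotated.be_mul_alS, mul_comm (2 - _), product_eq]

theorem one_le_terminal (h : p.Stopping Q D) (hQ : 10 ≤ Q) :
    1 ≤ 2 * p.ratio Q - 1 / stretch Q := by
  have := one_div_le_one_div_of_le (by norm_num) (le_stretch hQ)
  linarith [h.le_ratio (by linarith : 0 < Q)]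

theorem terminal_le_two (h : p.Stopping Q D) (hQ : 10 ≤ Q) :
    2 * p.ratio Q - 1 / stretch Q ≤ 2 := by
  have : 0 ≤ 1 / stretch Q := one_div_nonneg.2 (by linarith [le_stretch hQ])
  linarith [h.ratio_le_one (by linarith : 0 < Q)]

end Stopping

theorem initial_stopping {Q δ₀ α₀ : ℝ} (hδ₀ : 0 < δ₀) (hδ₀q : δ₀ ≤ q) (hα₀ : 0 < α₀) :
    (initial Q δ₀ α₀).Stopping Q (α₀ ^ 2 * (δ₀ / q) ^ 2) := by
  have q_pos : 0 < q := by norm_num [q]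
  constructor <;> simp only [initial]
  · exact hα₀
  · positivity
  · exact mul_le_of_le_one_right hα₀.le (pow_le_one₀ (by positivity) ((div_le_one q_pos).2 hδ₀q))
  · ring
  · field_simp
  · field_simp

theorem initial_delta {Q δ₀ α₀ : ℝ} (hδ₀ : 0 ≤ δ₀) (hα₀ : α₀ ≠ 0) :
    (initial Q δ₀ α₀).delta = δ₀ := by
  have q_pos : 0 < q := by norm_num [q]
  rw [delta, initial, mul_div_cancel_left₀ _ hα₀, Real.sqrt_sq (by positivity),
    mul_div_cancel₀ _ q_pos.ne']

end Eig

/-! ### The weight as a step function -/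

/-- The quantity `‖⟨W⟩_I^{1/2} ⟨W⁻¹⟩_I^{1/2}‖²` whose supremum over `I` is the `A₂`
characteristic. -/
def a2At (W : ℝ → Mat) (I : DyadicInterval) : ℝ :=
  opNorm (sqrtMat (average W I) * sqrtMat (average (fun x => (W x)⁻¹) I)) ^ 2

theorem inv_glue (V W : ℝ → Mat) :
    (fun x => (glue V W x)⁻¹) = glue (fun x => (V x)⁻¹) fun x => (W x)⁻¹ :=
  funext fun _ => apply_ite (fun A : Mat => A⁻¹) _ _ _

theorem a2At_glue_lower (V W : ℝ → Mat) (I : DyadicInterval) :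
    a2At (glue V W) I.lower = a2At V I := by
  rw [a2At, inv_glue, average_glue_lower, average_glue_lower, a2At]

theorem a2At_glue_upper (V W : ℝ → Mat) (I : DyadicInterval) :
    a2At (glue V W) I.upper = a2At W I := by
  rw [a2At, inv_glue, average_glue_upper, average_glue_upper, a2At]

theorem a2At_eval_root (t : DyadicTree Mat) :
    a2At t.eval root = opNorm (sqrtMat t.mean * sqrtMat t.meanInv) ^ 2 := by
  rw [a2At, ← DyadicTree.eval_inv, average_eval_root, average_eval_root, DyadicTree.meanInv]

theorem Axes.a2At_leaf {a b : Plane} (hab : Axes a b) {x y : ℝ} (hx : 0 < x) (hy : 0 < y)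
    (I : DyadicInterval) : a2At (DyadicTree.leaf (diagMat a b x y)).eval I = 1 := by
  rw [a2At, DyadicTree.eval, average_const, average_const, hab.diagMat_inv hx.ne' hy.ne',
    hab.opNorm_sqrtMat_mul_sqrtMat_sq hx.le hy.le (inv_nonneg.2 hx.le) (inv_nonneg.2 hy.le)
      (mul_inv_cancel₀ hx.ne') (mul_inv_cancel₀ hy.ne')]

theorem Axes.a2At_root {K : ℝ} {p : Eig} {a b : Plane} (hab : Axes a b) (hp : p.Balanced K)
    {t : DyadicTree Mat} (mean_eq : t.mean = diagMat a b p.beS p.alS)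
    (meanInv_eq : t.meanInv = diagMat a b p.al p.be) : a2At t.eval root = K := by
  rw [a2At_eval_root, mean_eq, meanInv_eq, hab.opNorm_sqrtMat_mul_sqrtMat_sq hp.beS_pos.le
    hp.alS_pos.le hp.al_pos.le hp.be_pos.le (mul_comm p.al _ ▸ hp.al_mul_beS)
    (mul_comm p.be _ ▸ hp.be_mul_alS)]

/-- The step function of `t` is a weight with averages `β# a a* + α# b b*`, its inverse has average
`α a a* + β b b*`, and its `A₂` characteristic is at most `Q`. -/
structure IsWeightTree (Q : ℝ) (p : Eig) (a b : Plane) (t : DyadicTree Mat) : Prop where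
  posDef : t.All Matrix.PosDef
  mean_eq : t.mean = diagMat a b p.beS p.alS
  meanInv_eq : t.meanInv = diagMat a b p.al p.be
  a2At_le : ∀ I, a2At t.eval I ≤ Q

namespace IsWeightTree

variable {Q K : ℝ} {p : Eig} {a b : Plane}

theorem leaf (hQ : 1 ≤ Q) (hab : Axes a b) {x y : ℝ} (hx : 0 < x) (hy : 0 < y) :
    IsWeightTree Q ⟨x⁻¹, y⁻¹, y, x⟩ a b (.leaf (diagMat a b x y)) :=
  ⟨hab.posDef_diagMat hx hy, rfl, hab.diagMat_inv hx.ne' hy.ne', fun I =>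
    (hab.a2At_leaf hx hy I).trans_le hQ⟩

/-- The characteristic only has to be checked on the whole interval, where it is `K`. -/
theorem node {pl pr : Eig} {al bl ar br : Plane} {l r : DyadicTree Mat} (hp : p.Balanced K)
    (hK : K ≤ Q) (hab : Axes a b) (hl : IsWeightTree Q pl al bl l) (hr : IsWeightTree Q pr ar br r)
    (mean : (1 / 2 : ℝ) • (diagMat al bl pl.beS pl.alS + diagMat ar br pr.beS pr.alS) =
      diagMat a b p.beS p.alS)
    (meanInv : (1 / 2 : ℝ) • (diagMat al bl pl.al pl.be + diagMat ar br pr.al pr.be) =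
      diagMat a b p.al p.be) : IsWeightTree Q p a b (.node l r) := by
  have mean_eq : (DyadicTree.node l r).mean = diagMat a b p.beS p.alS := by
    rw [DyadicTree.mean, hl.mean_eq, hr.mean_eq, mean]
  have meanInv_eq : (DyadicTree.node l r).meanInv = diagMat a b p.al p.be := by
    rw [DyadicTree.meanInv_node, hl.meanInv_eq, hr.meanInv_eq, meanInv]
  refine ⟨⟨hl.posDef, hr.posDef⟩, mean_eq, meanInv_eq, DyadicInterval.forall_iff.2 ⟨?_, ?_, ?_⟩⟩
  · exact (hab.a2At_root hp mean_eq meanInv_eq).trans_le hK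
  · exact fun I => (a2At_glue_lower _ _ I).trans_le (hl.a2At_le I)
  · exact fun I => (a2At_glue_upper _ _ I).trans_le (hr.a2At_le I)

theorem node_of_half_add {pl pr : Eig} {l r : DyadicTree Mat} (hp : p.Balanced K) (hK : K ≤ Q)
    (hab : Axes a b) (hl : IsWeightTree Q pl a b l) (hr : IsWeightTree Q pr a b r)
    (al : (pl.al + pr.al) / 2 = p.al) (be : (pl.be + pr.be) / 2 = p.be)
    (alS : (pl.alS + pr.alS) / 2 = p.alS) (beS : (pl.beS + pr.beS) / 2 = p.beS) :
    IsWeightTree Q p a b (.node l r) :=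
  node hp hK hab hl hr (by rw [half_smul_diagMat_add, beS, alS])
    (by rw [half_smul_diagMat_add, al, be])

theorem node_rotated {l r : DyadicTree Mat} (hp : p.Balanced K) (hK : K ≤ Q)
    (hδ : p.delta ^ 2 ≠ 1) (hab : Axes a b)
    (hl : IsWeightTree Q p.rotated (turn (-p.delta) a b) (turn p.delta b a) l)
    (hr : IsWeightTree Q p.rotated (turn p.delta a b) (turn (-p.delta) b a) r) :
    IsWeightTree Q p a b (.node l r) := by
  have average_rotated (x y : ℝ) :
      lam p.delta ^ 2 * ((x - p.delta ^ 2 * y) / (1 - p.delta ^ 2) +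
        p.delta ^ 2 * ((y - p.delta ^ 2 * x) / (1 - p.delta ^ 2))) = x := by
    have := sub_ne_zero.2 hδ.symm
    rw [show (x - p.delta ^ 2 * y) / (1 - p.delta ^ 2) +
        p.delta ^ 2 * ((y - p.delta ^ 2 * x) / (1 - p.delta ^ 2)) = (1 + p.delta ^ 2) * x by
      field_simp; ring, ← mul_assoc, lam_sq_mul, one_mul]
  refine node hp hK hab hl hr ?_ ?_ <;>
    simp only [diagMat_turn_add, Eig.rotated, average_rotated]

end IsWeightTree

/-- The step function `stopWeight` as a tree. -/
def stopTree (p : Eig) (a b : Plane) : DyadicTree Mat :=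
  let da := √(1 - 1 / (p.al * p.beS))
  let db := √(1 - 1 / (p.be * p.alS))
  .node (.leaf (diagMat a b (p.beS * (1 - da)) (p.alS * (1 - db))))
    (.leaf (diagMat a b (p.beS * (1 + da)) (p.alS * (1 + db))))

theorem eval_stopTree (p : Eig) (a b : Plane) : (stopTree p a b).eval = stopWeight p a b := rfl

/-- The step function `weightAux` as a tree. -/
def weightTree (Q : ℝ) : ℕ → Eig → Plane → Plane → DyadicTree Mat
  | 0, p, a, b => stopTree p a b
  | N + 1, p, a, b =>
    .node
      (.node (stopTree (p.terminal Q) (turn (-p.delta) a b) (turn p.delta b a))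
        (weightTree Q N (p.next Q) (turn (-p.delta) a b) (turn p.delta b a)))
      (.node (stopTree (p.terminal Q) (turn p.delta a b) (turn (-p.delta) b a))
        (weightTree Q N (p.next Q) (turn p.delta a b) (turn (-p.delta) b a)))

/-- The weight on a half of a stopping interval: its left half is a terminal interval and its right
half is a stopping interval. Here `p` are the eigenvalues on the stopping interval, and `a`, `b` are
the axes of the half. -/
def halfTree (Q : ℝ) (N : ℕ) (p : Eig) (a b : Plane) : DyadicTree Mat :=
  .node (stopTree (p.terminal Q) a b) (weightTree Q N (p.next Q) a b)

theorem weightTree_succ (Q : ℝ) (N : ℕ) (p : Eig) (a b : Plane) :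
    weightTree Q (N + 1) p a b =
      .node (halfTree Q N p (turn (-p.delta) a b) (turn p.delta b a))
        (halfTree Q N p (turn p.delta a b) (turn (-p.delta) b a)) := rfl

theorem eval_weightTree (Q : ℝ) (N : ℕ) (p : Eig) (a b : Plane) :
    (weightTree Q N p a b).eval = weightAux Q N p a b := by
  induction N generalizing p a b with
  | zero => exact eval_stopTree p a b
  | succ N ih =>
    funext x
    simp only [weightTree, DyadicTree.eval, weightAux, ih, eval_stopTree]
    rcases lt_or_ge x (1 / 2) with x_lt | x_ge
    · rw [glue_of_lt x_lt, if_pos x_lt]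
      rcases lt_or_ge x (1 / 4) with x_lt' | x_ge'
      · rw [glue_of_lt (by linarith), if_pos x_lt', ← mul_assoc]
        norm_num
      · rw [glue_of_le (by linarith), if_neg x_ge'.not_gt, ← mul_assoc]
        norm_num
    · rw [glue_of_le x_ge, if_neg (by linarith), if_neg x_ge.not_gt]
      rcases lt_or_ge x (3 / 4) with x_lt' | x_ge'
      · rw [glue_of_lt (by linarith), if_pos x_lt']
        congr 1
        ring
      · rw [glue_of_le (by linarith), if_neg x_ge'.not_gt]
        congr 1
        ring

theorem sqrt_one_sub_one_div_lt_one {K : ℝ} (hK : 0 < K) : √(1 - 1 / K) < 1 := by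
  rw [Real.sqrt_lt' one_pos, one_pow]
  exact sub_lt_self 1 (one_div_pos.2 hK)

theorem half_inv_add_inv {x y K : ℝ} (hK : 1 ≤ K) (hyx : y * x = K) :
    ((x * (1 - √(1 - 1 / K)))⁻¹ + (x * (1 + √(1 - 1 / K)))⁻¹) / 2 = y := by
  have K_pos : 0 < K := by linarith
  have x_ne_zero : x ≠ 0 := right_ne_zero_of_mul (hyx ▸ K_pos.ne')
  have sqrt_sq : √(1 - 1 / K) ^ 2 = 1 - 1 / K :=
    Real.sq_sqrt (sub_nonneg.2 ((div_le_one K_pos).2 hK))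
  have sqrt_lt_one := sqrt_one_sub_one_div_lt_one K_pos
  have sqrt_nonneg := Real.sqrt_nonneg (1 - 1 / K)
  generalize √(1 - 1 / K) = s at *
  have lower_ne_zero : 1 - s ≠ 0 := by linarith
  have upper_ne_zero : 1 + s ≠ 0 := by linarith
  calc ((x * (1 - s))⁻¹ + (x * (1 + s))⁻¹) / 2 = (x * ((1 - s) * (1 + s)))⁻¹ := by field_simp; ring
    _ = (x * (1 / K))⁻¹ := by rw [show (1 - s) * (1 + s) = 1 / K by linear_combination -sqrt_sq]
    _ = y := by rw [← hyx]; field_simp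

theorem isWeightTree_stopTree {Q K : ℝ} {p : Eig} {a b : Plane} (hp : p.Balanced K) (hK : 1 ≤ K)
    (hKQ : K ≤ Q) (hab : Axes a b) : IsWeightTree Q p a b (stopTree p a b) := by
  have lower_pos := sub_pos.2 (sqrt_one_sub_one_div_lt_one (zero_lt_one.trans_le hK))
  have upper_pos := add_pos_of_pos_of_nonneg one_pos (Real.sqrt_nonneg (1 - 1 / K))
  rw [stopTree, hp.al_mul_beS, hp.be_mul_alS]
  exact IsWeightTree.node_of_half_add hp hKQ hab
    (.leaf (hK.trans hKQ) hab (mul_pos hp.beS_pos lower_pos) (mul_pos hp.alS_pos lower_pos))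
    (.leaf (hK.trans hKQ) hab (mul_pos hp.beS_pos upper_pos) (mul_pos hp.alS_pos upper_pos))
    (half_inv_add_inv hK hp.al_mul_beS) (half_inv_add_inv hK hp.be_mul_alS) (by ring) (by ring)

section

variable {Q D : ℝ} {p : Eig} {a b : Plane}

theorem isWeightTree_terminal (hQ : 10 ≤ Q) (hp : p.Stopping Q D) (hab : Axes a b) :
    IsWeightTree Q (p.terminal Q) a b (stopTree (p.terminal Q) a b) :=
  isWeightTree_stopTree (hp.terminal_balanced hQ) (hp.one_le_terminal hQ)
    ((hp.terminal_le_two hQ).trans (by linarith)) hab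

theorem isWeightTree_half_node (hQ : 10 ≤ Q) (hp : p.Stopping Q D) (hab : Axes a b)
    {t : DyadicTree Mat} (ht : IsWeightTree Q (p.next Q) a b t) :
    IsWeightTree Q p.rotated a b (.node (stopTree (p.terminal Q) a b) t) := by
  have Q_pos : 0 < Q := by linarith
  refine .node_of_half_add (hp.rotated_balanced Q_pos)
    (mul_le_of_le_one_left Q_pos.le (hp.ratio_le_one Q_pos)) hab
    (isWeightTree_terminal hQ hp hab) ht ?_ ?_ ?_ ?_ <;>
  · simp only [Eig.terminal, Eig.next]
    ring

theorem isWeightTree_weightTree (hQ : 10 ≤ Q) (N : ℕ) (hp : p.Stopping Q D) (hab : Axes a b) :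
    IsWeightTree Q p a b (weightTree Q N p a b) := by
  induction N generalizing p a b with
  | zero => exact isWeightTree_stopTree (hp.balanced (by linarith)) (by linarith) le_rfl hab
  | succ N ih =>
    exact .node_rotated (hp.balanced (by linarith)) le_rfl (by linarith [hp.delta_sq_le]) hab
      (isWeightTree_half_node hQ hp (hab.turn_neg _) (ih (hp.next hQ) (hab.turn_neg _)))
      (isWeightTree_half_node hQ hp (hab.turn_pos _) (ih (hp.next hQ) (hab.turn_pos _)))

theorem isWeightTree_halfTree (hQ : 10 ≤ Q) (N : ℕ) (hp : p.Stopping Q D) (hab : Axes a b) :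
    IsWeightTree Q p.rotated a b (halfTree Q N p a b) :=
  isWeightTree_half_node hQ hp hab (isWeightTree_weightTree hQ N (hp.next hQ) hab)

theorem IsWeightTree.hasDyadicA2Char {t : DyadicTree Mat} (ht : IsWeightTree Q p a b t)
    (hp : p.Balanced Q) (hab : Axes a b) : HasDyadicA2Char t.eval Q :=
  ⟨Set.forall_mem_range.2 ht.a2At_le,
    fun _ h => (hab.a2At_root hp ht.mean_eq ht.meanInv_eq).ge.trans (h ⟨root, rfl⟩)⟩

end

/-! ### The recursion for the energy -/

/-- The increment of the average of `W⁻¹ e` between the halves of a stopping interval, as the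
coefficient of a Haar function. It is caused by the rotation of the axes. -/
def turnJump (p : Eig) (a b e : Plane) : Plane :=
  jump (act (diagMat (turn (-p.delta) a b) (turn p.delta b a) p.rotated.al p.rotated.be) e)
    (act (diagMat (turn p.delta a b) (turn (-p.delta) b a) p.rotated.al p.rotated.be) e)

/-- The increment of the average of `W⁻¹ e` between a terminal interval and the neighbouring
stopping interval, as the coefficient of a Haar function. It is caused by the stretching. -/
def stretchJump (Q : ℝ) (p : Eig) (a b e : Plane) : Plane :=
  jump (act (diagMat a b (p.terminal Q).al (p.terminal Q).be) e)
    (act (diagMat a b (p.next Q).al (p.next Q).be) e)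

theorem inner_jump (g u v : Plane) : ⟪g, jump u v⟫_ℝ = √2 / 2 * (⟪g, v⟫_ℝ - ⟪g, u⟫_ℝ) := by
  rw [jump, real_inner_smul_right, inner_sub_right]

theorem inner_act_diagMat (a b : Plane) (x y : ℝ) (e g : Plane) :
    ⟪g, act (diagMat a b x y) e⟫_ℝ = x * ⟪a, e⟫_ℝ * ⟪g, a⟫_ℝ + y * ⟪b, e⟫_ℝ * ⟪g, b⟫_ℝ := by
  rw [act_diagMat, inner_add_right, real_inner_smul_right, real_inner_smul_right]

theorem inner_turnJump (p : Eig) {a b : Plane} (hab : Axes a b) (e : Plane) :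
    ⟪a, turnJump p a b e⟫_ℝ =
      √2 * p.delta * lam p.delta ^ 2 * (p.rotated.al - p.rotated.be) * ⟪b, e⟫_ℝ := by
  simp only [turnJump, inner_jump, inner_act_diagMat, inner_turn_left, inner_turn_right,
    hab.inner_left_left, hab.inner_left_right, lam_neg]
  ring

theorem inner_stretchJump (Q : ℝ) (p : Eig) {a b : Plane} (hab : Axes a b) (e : Plane) :
    ⟪a, stretchJump Q p a b e⟫_ℝ = √2 * (stretch Q - 1) * p.rotated.al * ⟪a, e⟫_ℝ := by
  simp only [stretchJump, inner_jump, inner_act_diagMat, hab.inner_left_left, hab.inner_left_right,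
    Eig.terminal, Eig.next]
  ring

theorem mul_inner_sq_le_energy_stopTree {K : ℝ} {p : Eig} (hp : p.Balanced K) (hK₀ : 0 < K)
    (hK : K ≤ 2) (a b e G P : Plane) :
    p.alS / 4 * ⟪b, G⟫_ℝ ^ 2 ≤ (stopTree p a b).energy e G P := by
  have alS_pos := hp.alS_pos
  have beS_pos := hp.beS_pos
  have sqrt_nonneg := Real.sqrt_nonneg (1 - 1 / K)
  have sqrt_le : √(1 - 1 / K) ≤ 3 / 4 := by
    have := one_div_le_one_div_of_le hK₀ hK
    exact Real.sqrt_le_iff.2 ⟨by norm_num, by linarith⟩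
  have mul_inner_sq_le_quad {s : ℝ} (hs : 1 / 4 ≤ s) (g : Plane) :
      p.alS / 4 * ⟪b, g⟫_ℝ ^ 2 ≤ quad (diagMat a b (p.beS * s) (p.alS * s)) g := by
    rw [quad_diagMat]
    have : 0 ≤ p.beS * s * ⟪a, g⟫_ℝ ^ 2 := by positivity
    have : p.alS / 4 * ⟪b, g⟫_ℝ ^ 2 ≤ p.alS * s * ⟪b, g⟫_ℝ ^ 2 :=
      mul_le_mul_of_nonneg_right (by nlinarith) (sq_nonneg _)
    linarith
  rw [stopTree, hp.al_mul_beS, hp.be_mul_alS]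
  refine DyadicTree.mul_inner_sq_le_energy (c := p.alS / 4) (b := b) (by positivity) e ?_ G P
  exact ⟨mul_inner_sq_le_quad (by linarith), mul_inner_sq_le_quad (by linarith)⟩

section

variable {Q D : ℝ} {p : Eig} {a b e : Plane}

theorem energy_halfTree (hQ : 10 ≤ Q) (N : ℕ) (hp : p.Stopping Q D) (hab : Axes a b)
    (e G P : Plane) : (halfTree Q N p a b).energy e G P =
      1 / 2 * ((stopTree (p.terminal Q) a b).energy e (G - P) (-stretchJump Q p a b e) +
        (weightTree Q N (p.next Q) a b).energy e (G + P) (stretchJump Q p a b e)) := by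
  rw [halfTree, DyadicTree.energy, (isWeightTree_terminal hQ hp hab).meanInv_eq,
    (isWeightTree_weightTree hQ N (hp.next hQ) hab).meanInv_eq, stretchJump]

theorem energy_weightTree_succ (hQ : 10 ≤ Q) (N : ℕ) (hp : p.Stopping Q D) (hab : Axes a b)
    (e G P : Plane) : (weightTree Q (N + 1) p a b).energy e G P =
      1 / 2 * ((halfTree Q N p (turn (-p.delta) a b) (turn p.delta b a)).energy e (G - P)
          (-turnJump p a b e) +
        (halfTree Q N p (turn p.delta a b) (turn (-p.delta) b a)).energy e (G + P)
          (turnJump p a b e)) := by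
  rw [weightTree_succ, DyadicTree.energy,
    (isWeightTree_halfTree hQ N hp (hab.turn_neg p.delta)).meanInv_eq,
    (isWeightTree_halfTree hQ N hp (hab.turn_pos p.delta)).meanInv_eq, turnJump]

/-! ### The direction of the test vector -/

/-- The vector `e` is so close to the axis `a` that this remains true, in the same sense, on all
later stopping intervals. The term `4 δ` makes room for the rotations that are still to come; their
angles decrease geometrically. -/
structure Aligned (p : Eig) (a b e : Plane) : Prop where
  axes : Axes a b
  delta_le : p.delta ≤ 1 / 40
  inner_self_le : ⟪e, e⟫_ℝ ≤ 2
  le_inner : 1 / 2 + 4 * p.delta ≤ ⟪a, e⟫_ℝ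

namespace Aligned

theorem abs_inner_right_le (h : Aligned p a b e) : |⟪b, e⟫_ℝ| ≤ 3 / 2 := by
  have := h.axes.inner_self e
  have := h.inner_self_le
  exact abs_le_of_sq_le_sq (by nlinarith [sq_nonneg ⟪a, e⟫_ℝ]) (by norm_num)

theorem next (h : Aligned p a b e) (hp : p.Stopping Q D) (hQ : 10 ≤ Q) {δ : ℝ}
    (hδ : |δ| = p.delta) : Aligned (p.next Q) (turn δ a b) (turn (-δ) b a) e := by
  have next_delta_le := hp.next_delta_le hQ
  have delta_pos := hp.delta_pos
  have delta_le := h.delta_le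
  refine ⟨h.axes.turn_pos δ, by linarith, h.inner_self_le, ?_⟩
  have inner_right_ge : -(p.delta * (3 / 2)) ≤ δ * ⟪b, e⟫_ℝ := by
    refine neg_le_of_abs_le ?_
    rw [abs_mul, hδ]
    exact mul_le_mul_of_nonneg_left h.abs_inner_right_le delta_pos.le
  have lam_ge : 1 - p.delta / 80 ≤ lam δ := by
    refine le_trans ?_ (one_sub_half_sq_le_lam δ)
    rw [← sq_abs, hδ]
    nlinarith
  calc 1 / 2 + 4 * (p.next Q).delta
      ≤ (1 - p.delta / 80) * (1 / 2 + 5 / 2 * p.delta) := by nlinarith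
    _ ≤ lam δ * (⟪a, e⟫_ℝ + δ * ⟪b, e⟫_ℝ) :=
        mul_le_mul lam_ge (by linarith [h.le_inner]) (by positivity) (lam_pos δ).le
    _ = ⟪turn δ a b, e⟫_ℝ := (inner_turn_left δ a b e).symm

theorem next_pos (h : Aligned p a b e) (hp : p.Stopping Q D) (hQ : 10 ≤ Q) :
    Aligned (p.next Q) (turn p.delta a b) (turn (-p.delta) b a) e :=
  h.next hp hQ (abs_of_pos hp.delta_pos)

theorem next_neg (h : Aligned p a b e) (hp : p.Stopping Q D) (hQ : 10 ≤ Q) :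
    Aligned (p.next Q) (turn (-p.delta) a b) (turn p.delta b a) e := by
  simpa only [neg_neg] using h.next hp hQ (δ := -p.delta)
    ((abs_neg _).trans (abs_of_pos hp.delta_pos))

end Aligned

/-- The amount by which the component of the Haar shift along `-b` grows per generation. -/
def drift (D : ℝ) : ℝ := √D / 80

theorem Eig.Stopping.drift_pos (hp : p.Stopping Q D) : 0 < drift D :=
  div_pos (Real.sqrt_pos.2 hp.pos) (by norm_num)

theorem Eig.Stopping.delta_mul_al (hp : p.Stopping Q D) : p.delta * p.al = 8 * drift D := by
  rw [mul_comm, hp.al_mul_delta, drift]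
  ring

theorem two_mul_drift_le (hQ : 10 ≤ Q) (hp : p.Stopping Q D) (h : Aligned (p.next Q) a b e) :
    2 * drift D ≤ (p.next Q).delta * ⟪a, stretchJump Q p a b e⟫_ℝ := by
  have stretch_ge := le_stretch hQ
  have rotated_al_pos := hp.rotated_al_pos
  have next_delta_pos := (hp.next hQ).delta_pos
  have le_sqrt_two : 7 / 5 ≤ √(2 : ℝ) := Real.le_sqrt_of_sq_le (by norm_num)
  have inner_ge : 1 / 2 ≤ ⟪a, e⟫_ℝ := by linarith [h.le_inner]
  have factor_ge : stretch Q / 4 ≤ 7 / 5 * ((stretch Q - 1) * (1 / 2)) := by linarith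
  calc 2 * drift D = (p.next Q).delta * (stretch Q / 4 * p.rotated.al) := by
        have := (hp.next hQ).delta_mul_al
        simp only [Eig.next] at this ⊢
        linarith
    _ ≤ (p.next Q).delta * (√2 * ((stretch Q - 1) * ⟪a, e⟫_ℝ) * p.rotated.al) := by
        have : 0 ≤ stretch Q - 1 := by linarith
        gcongr
        exact factor_ge.trans (by gcongr)
    _ = _ := by
        rw [inner_stretchJump Q p h.axes]
        ring

theorem abs_delta_mul_inner_turnJump_le (hp : p.Stopping Q D) (h : Aligned p a b e) :
    |p.delta * ⟪a, turnJump p a b e⟫_ℝ| ≤ drift D := by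
  have delta_pos := hp.delta_pos
  have al_pos := hp.al_pos
  have rotated_sub_nonneg := sub_nonneg.2 hp.rotated_be_le_rotated_al
  have rotated_sub_le : p.rotated.al - p.rotated.be ≤ 2 * p.al := by
    linarith [hp.rotated_al_le, hp.rotated_be_pos]
  have sqrt_two_le : √2 ≤ 3 / 2 := Real.sqrt_le_iff.2 (by norm_num)
  rw [inner_turnJump p h.axes, abs_mul, abs_mul, abs_of_pos delta_pos,
    abs_of_nonneg (by positivity)]
  calc p.delta * (√2 * p.delta * lam p.delta ^ 2 * (p.rotated.al - p.rotated.be) * |⟪b, e⟫_ℝ|)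
      ≤ p.delta * (3 / 2 * (1 / 40) * 1 ^ 2 * (2 * p.al) * (3 / 2)) := by
        have := h.abs_inner_right_le
        have := h.delta_le
        have := lam_pos p.delta
        have := lam_le_one p.delta
        gcongr
    _ = 9 / 80 * (p.delta * p.al) := by ring
    _ ≤ drift D := by linarith [hp.delta_mul_al, hp.drift_pos]

/-! ### The lower bound for the energy -/

theorem two_mul_sq_mul_posPart_le {c x u v : ℝ} (hc : 0 ≤ c) (h : 2 * (c * x) ≤ u + v) :
    2 * (c * x⁺) ^ 2 ≤ u⁺ ^ 2 + v⁺ ^ 2 := by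
  have mul_posPart_le : 2 * (c * x⁺) ≤ u⁺ + v⁺ := by
    rcases le_total 0 x with hx | hx
    · rw [posPart_eq_self.2 hx]
      linarith [le_posPart u, le_posPart v]
    · rw [posPart_eq_zero.2 hx]
      linarith [posPart_nonneg u, posPart_nonneg v]
  have := pow_le_pow_left₀ (by have := posPart_nonneg x; positivity) mul_posPart_le 2
  nlinarith [sq_nonneg (u⁺ - v⁺)]

theorem sq_posPart_le_sq (x : ℝ) : x⁺ ^ 2 ≤ x ^ 2 := by
  rw [← sq_abs x]
  exact pow_le_pow_left₀ (posPart_nonneg x) (sup_le (le_abs_self x) (abs_nonneg x)) 2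

/-- A lower bound for the contribution of the terminal intervals created `n` generations later to
the energy on a stopping interval, where `y` is the component of the Haar shift along `-b`. -/
def level (Q D : ℝ) (p : Eig) (y : ℝ) (n : ℕ) : ℝ :=
  p.al / (8 * D) * (stretch Q / 2) ^ n * ((1 - p.delta ^ 2) * (y + (n + 1) * drift D)⁺) ^ 2

theorem level_nonneg (hQ : 10 ≤ Q) (hp : p.Stopping Q D) (y : ℝ) (n : ℕ) :
    0 ≤ level Q D p y n := by
  have := hp.al_pos
  have := hp.pos
  have := le_stretch hQ
  unfold level
  positivity

theorem level_zero_le (hQ : 10 ≤ Q) (hp : p.Stopping Q D) {y u v : ℝ}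
    (h : 2 * (lam p.delta * (y + drift D)) ≤ u + v) :
    level Q D p y 0 ≤
      1 / 4 * ((p.terminal Q).alS / 4 * u ^ 2 + (p.terminal Q).alS / 4 * v ^ 2) := by
  have D_pos := hp.pos
  have := posPart_nonneg (y + drift D)
  have lam_pos := lam_pos p.delta
  have one_sub_nonneg := hp.one_sub_delta_sq_pos.le
  have one_sub_le_lam : 1 - p.delta ^ 2 ≤ lam p.delta :=
    le_trans (by linarith [sq_nonneg p.delta]) (one_sub_half_sq_le_lam p.delta)
  have rotated_al_pos := hp.rotated_al_pos
  rw [hp.terminal_alS (by linarith)]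
  calc level Q D p y 0
      = p.al / D / 16 * (2 * ((1 - p.delta ^ 2) * (y + drift D)⁺) ^ 2) := by
        simp only [level, Nat.cast_zero, zero_add, one_mul, pow_zero]
        ring
    _ ≤ p.rotated.al / D / 16 * (2 * (lam p.delta * (y + drift D)⁺) ^ 2) := by
        have := hp.al_le_rotated_al
        gcongr
    _ ≤ p.rotated.al / D / 16 * (u ^ 2 + v ^ 2) := by
        refine mul_le_mul_of_nonneg_left ?_ (by positivity)
        linarith [two_mul_sq_mul_posPart_le lam_pos.le h, sq_posPart_le_sq u, sq_posPart_le_sq v]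
    _ = _ := by ring

theorem level_succ_le (hQ : 10 ≤ Q) (hp : p.Stopping Q D) (n : ℕ) {y u v : ℝ}
    (h : 2 * (lam p.delta * (y + drift D)) ≤ u + v) :
    level Q D p y (n + 1) ≤ 1 / 4 * (level Q D (p.next Q) u n + level Q D (p.next Q) v n) := by
  have D_pos := hp.pos
  have stretch_pos : 0 < stretch Q := by linarith [le_stretch hQ]
  have al_mul_stretch_le := hp.al_mul_stretch_le hQ
  have one_sub_nonneg := hp.one_sub_delta_sq_pos.le
  have next_al_pos := (hp.next hQ).al_pos
  set x := y + ((n : ℝ) + 2) * drift D with hx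
  have one_sub_le : 1 - p.delta ^ 2 ≤ (1 - (p.next Q).delta ^ 2) * lam p.delta := by
    have next_delta_sq_le : (p.next Q).delta ^ 2 ≤ p.delta ^ 2 / 2 := by
      nlinarith [hp.next_delta_le hQ, (hp.next hQ).delta_pos]
    nlinarith [one_sub_half_sq_le_lam p.delta, hp.delta_sq_le, sq_nonneg (p.delta ^ 2)]
  have average_le : 2 * (lam p.delta * x⁺) ^ 2 ≤
      (u + (n + 1) * drift D)⁺ ^ 2 + (v + (n + 1) * drift D)⁺ ^ 2 := by
    refine two_mul_sq_mul_posPart_le (lam_pos _).le ?_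
    have : lam p.delta * ((n + 1) * drift D) ≤ 1 * ((n + 1) * drift D) :=
      mul_le_mul_of_nonneg_right (lam_le_one _) (by have := hp.drift_pos; positivity)
    linarith
  calc level Q D p y (n + 1)
      = p.al * stretch Q / (16 * D) * (stretch Q / 2) ^ n * ((1 - p.delta ^ 2) * x⁺) ^ 2 := by
        rw [level, hx]
        push_cast
        ring_nf
    _ ≤ (p.next Q).al / (16 * D) * (stretch Q / 2) ^ n *
          ((1 - (p.next Q).delta ^ 2) * lam p.delta * x⁺) ^ 2 := by
        have := posPart_nonneg x
        gcongr
    _ = (p.next Q).al / (32 * D) * (stretch Q / 2) ^ n * (1 - (p.next Q).delta ^ 2) ^ 2 *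
          (2 * (lam p.delta * x⁺) ^ 2) := by ring
    _ ≤ (p.next Q).al / (32 * D) * (stretch Q / 2) ^ n * (1 - (p.next Q).delta ^ 2) ^ 2 *
          ((u + (n + 1) * drift D)⁺ ^ 2 + (v + (n + 1) * drift D)⁺ ^ 2) :=
        mul_le_mul_of_nonneg_left average_le (by positivity)
    _ = _ := by
        unfold level
        ring

theorem neg_inner_turn_add (δ : ℝ) (a b G V : Plane) :
    -⟪turn δ b a, G - V⟫_ℝ + -⟪turn (-δ) b a, G + V⟫_ℝ =
      2 * (lam δ * (-⟪b, G⟫_ℝ + δ * ⟪a, V⟫_ℝ)) := by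
  simp only [inner_turn_left, inner_sub_right, inner_add_right, lam_neg]
  ring

theorem le_energy_halfTree (hQ : 10 ≤ Q) {N : ℕ} (hp : p.Stopping Q D) (hab : Axes a b) {S : ℝ}
    {G P : Plane} (hS : S ≤ (weightTree Q N (p.next Q) a b).energy e (G + P)
      (stretchJump Q p a b e)) :
    1 / 2 * ((p.terminal Q).alS / 4 * (-⟪b, G - P⟫_ℝ) ^ 2 + S) ≤
      (halfTree Q N p a b).energy e G P := by
  rw [energy_halfTree hQ N hp hab, neg_sq]
  gcongr
  exact mul_inner_sq_le_energy_stopTree (hp.terminal_balanced hQ)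
    (zero_lt_one.trans_le (hp.one_le_terminal hQ)) (hp.terminal_le_two hQ) ..

theorem sum_level_le_energy (hQ : 10 ≤ Q) (N : ℕ) (hp : p.Stopping Q D) (h : Aligned p a b e)
    {y : ℝ} {G P : Plane} (hy : y + 2 * drift D ≤ -⟪b, G⟫_ℝ + p.delta * ⟪a, P⟫_ℝ) :
    ∑ n ∈ Finset.range N, level Q D p y n ≤ (weightTree Q N p a b).energy e G P := by
  induction N generalizing p a b y G P with
  | zero =>
    rw [Finset.range_zero, Finset.sum_empty]
    exact DyadicTree.energy_nonneg ((isWeightTree_weightTree hQ 0 hp h.axes).posDef.imp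
      fun _ hA => hA.posSemidef) e G P
  | succ N ih =>
    have hl := h.next_neg hp hQ
    have hr := h.next_pos hp hQ
    set J := turnJump p a b e
    have energy_left := le_energy_halfTree hQ hp hl.axes (ih (hp.next hQ) hl
      (add_le_add_right (two_mul_drift_le hQ hp hl) (-⟪turn p.delta b a, G - P + -J⟫_ℝ)))
    have energy_right := le_energy_halfTree hQ hp hr.axes (ih (hp.next hQ) hr
      (add_le_add_right (two_mul_drift_le hQ hp hr) (-⟪turn (-p.delta) b a, G + P + J⟫_ℝ)))
    have drift_step {V : Plane} (hV : y + drift D ≤ -⟪b, G⟫_ℝ + p.delta * ⟪a, V⟫_ℝ) :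
        2 * (lam p.delta * (y + drift D)) ≤
          -⟪turn p.delta b a, G - V⟫_ℝ + -⟪turn (-p.delta) b a, G + V⟫_ℝ := by
      rw [neg_inner_turn_add]
      have := lam_pos p.delta
      gcongr
    have turnJump_le := abs_le.1 (abs_delta_mul_inner_turnJump_le hp h)
    have terminal_le := level_zero_le hQ hp (drift_step (V := P - J) (by
      rw [inner_sub_right, mul_sub]; linarith))
    have stopping_le (n : ℕ) := level_succ_le hQ hp n (drift_step (V := P + J) (by
      rw [inner_add_right, mul_add]; linarith))
    have sum_stopping_le := Finset.sum_le_sum fun n (_ : n ∈ Finset.range N) => stopping_le n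
    rw [← Finset.mul_sum, Finset.sum_add_distrib] at sum_stopping_le
    rw [Finset.sum_range_succ', energy_weightTree_succ hQ N hp h.axes]
    rw [sub_neg_eq_add, ← sub_eq_add_neg, sub_sub, sub_add] at energy_left
    rw [add_sub_assoc, add_assoc] at energy_right
    linarith

theorem half_le_pow_stretch (hQ : 1 ≤ Q) {n : ℕ} (hn : n ≤ Q) : 1 / 2 ≤ (stretch Q / 2) ^ n := by
  have : 0 < Q := by linarith
  have bernoulli := one_add_mul_le_pow (a := -(1 / (2 * Q))) (by
    rw [neg_le_neg_iff, div_le_iff₀ (by positivity)]; linarith) n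
  have mul_le : (n : ℝ) * (1 / (2 * Q)) ≤ 1 / 2 := by
    rw [mul_one_div, div_le_iff₀ (by positivity)]
    linarith
  have stretch_eq : stretch Q / 2 = 1 + -(1 / (2 * Q)) := by
    rw [stretch]
    field_simp
    ring
  rw [stretch_eq]
  linarith

theorem le_level_succ (hQ : 10 ≤ Q) (hp : p.Stopping Q D) {n : ℕ} (hn : n + 1 ≤ Q) :
    p.al / 409600 * n ^ 2 ≤ level Q D p (-(2 * drift D)) (n + 1) := by
  have D_pos := hp.pos
  have al_pos := hp.al_pos
  have drift_pos := hp.drift_pos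
  have half_le_pow := half_le_pow_stretch (by linarith : 1 ≤ Q) (n := n + 1) (by exact_mod_cast hn)
  have half_le_one_sub : 1 / 2 ≤ 1 - p.delta ^ 2 := by linarith [hp.delta_sq_le]
  have drift_sq : drift D ^ 2 = D / 6400 := by
    rw [drift, div_pow, Real.sq_sqrt D_pos.le]
    norm_num
  have arg_eq : -(2 * drift D) + ((n + 1 : ℕ) + 1) * drift D = n * drift D := by
    push_cast
    ring
  rw [level, arg_eq, posPart_eq_self.2 (by positivity)]
  calc p.al / 409600 * n ^ 2
      = p.al / (8 * D) * (1 / 2) * (1 / 2 * (n * drift D)) ^ 2 := by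
        rw [mul_pow, mul_pow, drift_sq]
        field_simp
        ring
    _ ≤ _ := by gcongr

end

theorem sum_range_sq (m : ℕ) :
    ∑ n ∈ Finset.range m, (n : ℝ) ^ 2 = m * (m - 1) * (2 * m - 1) / 6 := by
  induction m with
  | zero => simp
  | succ m ih =>
    rw [Finset.sum_range_succ, ih]
    push_cast
    ring

theorem cube_le_energy_weightTree {Q D : ℝ} {p : Eig} {a b e : Plane} (hQ : 10 ≤ Q) {N : ℕ}
    (hN : Q < N) (hp : p.Stopping Q D) (h : Aligned p a b e) :
    p.al / 409600 * (Q ^ 3 / 24) ≤ (weightTree Q N p a b).energy e 0 0 := by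
  have floor_lt : ⌊Q⌋₊ < N := (Nat.floor_lt (by linarith)).2 hN
  have lt_floor : Q < ⌊Q⌋₊ + 1 := Nat.lt_floor_add_one Q
  have al_pos := hp.al_pos
  calc p.al / 409600 * (Q ^ 3 / 24) = p.al / 409600 * (Q / 2 * (Q / 2) * Q / 6) := by ring
    _ ≤ p.al / 409600 * (⌊Q⌋₊ * (⌊Q⌋₊ - 1) * (2 * ⌊Q⌋₊ - 1) / 6) := by
        have : (0 : ℝ) ≤ ⌊Q⌋₊ - 1 := by linarith
        gcongr <;> linarith
    _ = ∑ n ∈ Finset.range ⌊Q⌋₊, p.al / 409600 * (n : ℝ) ^ 2 := by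
        rw [← sum_range_sq, Finset.mul_sum]
    _ ≤ ∑ n ∈ Finset.range ⌊Q⌋₊, level Q D p (-(2 * drift D)) (n + 1) :=
        Finset.sum_le_sum fun n hn => le_level_succ hQ hp (by
          exact_mod_cast (Nat.le_floor_iff (by linarith)).1 (Finset.mem_range.1 hn))
    _ ≤ ∑ n ∈ Finset.range (⌊Q⌋₊ + 1), level Q D p (-(2 * drift D)) n := by
        rw [Finset.sum_range_succ']
        exact le_add_of_nonneg_right (level_nonneg hQ hp _ _)
    _ ≤ ∑ n ∈ Finset.range N, level Q D p (-(2 * drift D)) n :=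
        Finset.sum_le_sum_of_subset_of_nonneg (Finset.range_mono floor_lt)
          fun n _ _ => level_nonneg hQ hp _ n
    _ ≤ (weightTree Q N p a b).energy e 0 0 := sum_level_le_energy hQ N hp h (by simp)

theorem DyadicTree.isMatrixWeight_inv_eval {t : DyadicTree Mat} (ht : t.All Matrix.PosDef) :
    IsMatrixWeight fun x => (t.eval x)⁻¹ := by
  rw [← t.eval_inv]
  exact isMatrixWeight_eval (All.map (fun _ hA => hA.inv.posSemidef) ht)

theorem weight_eq_eval (Q δ₀ α₀ : ℝ) (u : OrthonormalBasis (Fin 2) ℝ Plane) (N : ℕ) :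
    weight Q δ₀ α₀ u N = (weightTree Q N (Eig.initial Q δ₀ α₀) (u 0) (u 1)).eval :=
  (eval_weightTree ..).symm

section

variable {a b : Plane}

theorem Axes.inner_left_add_smul (hab : Axes a b) (t : ℝ) : ⟪a, a + t • b⟫_ℝ = 1 := by
  rw [inner_add_right, real_inner_smul_right, hab.inner_left_left, hab.inner_left_right, mul_zero,
    add_zero]

theorem Axes.inner_right_add_smul (hab : Axes a b) (t : ℝ) : ⟪b, a + t • b⟫_ℝ = t := by
  rw [inner_add_right, real_inner_smul_right, hab.inner_right_left, hab.inner_right_right, mul_one,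
    zero_add]

theorem Axes.aligned_add_smul (hab : Axes a b) {p : Eig} (hδ : p.delta ≤ 1 / 40) {t : ℝ}
    (ht : |t| ≤ 1) : Aligned p a b (a + t • b) where
  axes := hab
  delta_le := hδ
  inner_self_le := by
    rw [hab.inner_self, hab.inner_left_add_smul, hab.inner_right_add_smul]
    linarith [(sq_le_one_iff_abs_le_one t).2 ht]
  le_inner := by
    rw [hab.inner_left_add_smul]
    linarith

theorem normL2_testFunction_weightTree {Q D : ℝ} {p : Eig} (hQ : 10 ≤ Q) (N : ℕ)
    (hp : p.Stopping Q D) (hab : Axes a b) (t : ℝ) :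
    normL2 (weightTree Q N p a b).eval (testFunction (weightTree Q N p a b).eval (a + t • b)) =
      √(p.al + p.be * t ^ 2) := by
  have hW := isWeightTree_weightTree hQ N hp hab
  rw [DyadicTree.normL2_testFunction hW.posDef, hW.meanInv_eq, real_inner_comm, ← quad,
    quad_diagMat, hab.inner_left_add_smul, hab.inner_right_add_smul, one_pow, mul_one]

theorem mul_normL2_testFunction_le_normL2_haarShift {Q D : ℝ} {p : Eig} (hQ : 10 ≤ Q) {N : ℕ}
    (hN : Q < N) (hp : p.Stopping Q D) (hδ : p.delta ≤ 1 / 40) (hab : Axes a b) {t : ℝ}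
    (ht : |t| ≤ 1) {f : ℝ → Plane}
    (hf : f = testFunction (weightTree Q N p a b).eval (a + t • b)) :
    1 / 10 ^ 4 * Q ^ (3 / 2 : ℝ) * normL2 (weightTree Q N p a b).eval f ≤
      normL2 (weightTree Q N p a b).eval (haarShift f) := by
  have al_pos := hp.al_pos
  have be_pos := hp.be_pos
  have rpow_sq : (Q ^ (3 / 2 : ℝ)) ^ 2 = Q ^ 3 := by
    rw [← Real.rpow_mul_natCast (by linarith), ← Real.rpow_natCast Q 3]
    norm_num
  have sq_norm_le : p.al + p.be * t ^ 2 ≤ 2 * p.al := by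
    linarith [mul_le_mul hp.be_le_al ((sq_le_one_iff_abs_le_one t).2 ht) (sq_nonneg t) al_pos.le]
  rw [hf, normL2_testFunction_weightTree hQ N hp hab, DyadicTree.normL2_haarShift_testFunction]
  refine Real.le_sqrt_of_sq_le ?_
  calc (1 / 10 ^ 4 * Q ^ (3 / 2 : ℝ) * √(p.al + p.be * t ^ 2)) ^ 2
      = 1 / 10 ^ 8 * Q ^ 3 * (p.al + p.be * t ^ 2) := by
        rw [mul_pow, mul_pow, rpow_sq, Real.sq_sqrt (by positivity)]
        norm_num
    _ ≤ 1 / 10 ^ 8 * Q ^ 3 * (2 * p.al) := by gcongr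
    _ ≤ p.al / 409600 * (Q ^ 3 / 24) := by
        linarith [show 0 < p.al * Q ^ 3 by positivity]
    _ ≤ _ := cube_le_energy_weightTree hQ hN hp (hab.aligned_add_smul hδ ht)

end

end HaarLower

end

open HaarLower in
theorem theorem5_general {Q δ₀ α₀ : ℝ} (hQ : 10 ≤ Q) (hδ₀ : 0 < δ₀) (hδ₀' : δ₀ ≤ 1 / 40)
    (hα₀ : 0 < α₀) {N : ℕ} (hN : Q < N) (u : OrthonormalBasis (Fin 2) ℝ Plane) {W : ℝ → Mat}
    (hW : W = weight Q δ₀ α₀ u N) :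
    (IsMatrixWeight W ∧ (∀ x, (W x).PosDef) ∧ IsMatrixWeight (fun x => (W x)⁻¹) ∧
        HasDyadicA2Char W Q) ∧
      ∀ t : ℝ, |t| ≤ 1 → ∀ f, f = testFunction W (u 0 + t • u 1) →
        MemL2 W f ∧ 0 < normL2 W f ∧ {I | haarCoeff f I ≠ 0}.Finite ∧
          MemL2 W (haarShift f) ∧
          1 / 10 ^ 4 * Q ^ (3 / 2 : ℝ) * normL2 W f ≤ normL2 W (haarShift f) := by
  rw [weight_eq_eval] at hW
  subst hW
  have hab := axes_orthonormalBasis u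
  have hp := Eig.initial_stopping (Q := Q) hδ₀ (by norm_num [q]; linarith) hα₀
  have hδ := Eig.initial_delta (Q := Q) hδ₀.le hα₀.ne'
  have hW := isWeightTree_weightTree hQ N hp hab
  refine ⟨⟨DyadicTree.isMatrixWeight_eval (hW.posDef.imp fun _ hA => hA.posSemidef),
    hW.posDef.eval, DyadicTree.isMatrixWeight_inv_eval hW.posDef,
    hW.hasDyadicA2Char (hp.balanced (by linarith)) hab⟩, fun t ht f hf => ?_⟩
  have haarShift_ge := mul_normL2_testFunction_le_normL2_haarShift hQ hN hp
    (hδ.trans_le hδ₀') hab ht hf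
  subst hf
  refine ⟨DyadicTree.memL2_testFunction hW.posDef _, ?_,
    DyadicTree.finite_haarCoeff_testFunction_ne_zero _ _,
    DyadicTree.memL2_haarShift_testFunction _ _, haarShift_ge⟩
  rw [normL2_testFunction_weightTree hQ N hp hab]
  have := hp.al_pos
  have := hp.be_pos
  positivity

theorem theorem5 :
    ∃ c : ℝ, 0 < c ∧ ∃ Q₀ : ℝ, 1 ≤ Q₀ ∧ ∀ Q : ℝ, Q₀ ≤ Q →
      ∃ δs : ℝ, 0 < δs ∧ ∀ δ₀ : ℝ, 0 < δ₀ → δ₀ < δs →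
        ∃ N₀ : ℕ, ∀ N : ℕ, N₀ ≤ N → ∀ α₀ : ℝ, 0 < α₀ →
          ∀ u : OrthonormalBasis (Fin 2) ℝ HaarLower.Plane,
          ∀ W : ℝ → HaarLower.Mat, W = HaarLower.weight Q δ₀ α₀ u N →
            (HaarLower.IsMatrixWeight W ∧ (∀ x ∈ HaarLower.unitInterval, (W x).PosDef) ∧
                HaarLower.IsMatrixWeight (fun x => (W x)⁻¹) ∧
                HaarLower.HasDyadicA2Char W Q) ∧
              ∀ e : HaarLower.Plane, (e = u 0 ∨ e = u 0 + u 1) →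
                ∀ f : ℝ → HaarLower.Plane, f = HaarLower.testFunction W e →
                  HaarLower.MemL2 W f ∧ 0 < HaarLower.normL2 W f ∧
                  {I : HaarLower.DyadicInterval | HaarLower.haarCoeff f I ≠ 0}.Finite ∧
                  HaarLower.MemL2 W (HaarLower.haarShift f) ∧
                  c * Q ^ (3 / 2 : ℝ) * HaarLower.normL2 W f ≤
                    HaarLower.normL2 W (HaarLower.haarShift f) := by
  refine ⟨1 / 10 ^ 4, by norm_num, 10, by norm_num, fun Q hQ => ⟨1 / 40, by norm_num,
    fun δ₀ hδ₀ hδ₀' => ⟨⌊Q⌋₊ + 1, fun N hN α₀ hα₀ u W hW => ?_⟩⟩⟩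
  have ⟨weight, test⟩ :=
    theorem5_general hQ hδ₀ hδ₀'.le hα₀ (Nat.lt_of_floor_lt hN) u hW
  refine ⟨⟨weight.1, fun x _ => weight.2.1 x, weight.2.2⟩, ?_⟩
  rintro e (rfl | rfl) f hf
  · exact test 0 (by norm_num) f (by simpa only [zero_smul, add_zero] using hf)
  · exact test 1 (by norm_num) f (by simpa only [one_smul] using hf)
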